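/- For positive integers $k,d,n$ let $f_{k,d}(n)$ be the maximal size of a set $A\subseteq\{1,\dots,n\}$ such that the equation $a_1a_2\cdots a_k=x^d$ has no solution with (not necessarily distinct) $a_1,\dots,a_k\in A$ and integer $x$, except trivial solutions, i.e. those for which the multiset of the $a_i$ can be partitioned into $d$-tuples, each consisting of $d$ copies of the same number. (For $k=d=3$ the trivial solutions are those with $a_1=a_2=a_3$.) Let $p_1<p_2<\dots$ be the primes. For integers $r,i\ge 0$ let $$L_r(i)=\{p_1^{\alpha_1}\cdots p_r^{\alpha_r}\le i:\ \alpha_1,\dots,\alpha_r\in\{0,1,2\}\},$$ and let $s_r(i)$ be the largest size of a subset of $L_r(i)$ in which $a_1a_2a_3=x^3$ has only trivial solutions. With $N_r=p_1^2\cdots p_r^2$ put $$\gamma_r=\left(\frac{s_r(N_r)}{N_r}+\sum_{i=1}^{N_r-1}\frac{s_r(i)}{i(i+1)}\right)\prod_{j=1}^r\left(1-\frac1{p_j}\right),\qquad \beta_r=\gamma_r\prod_{j>r}\left(1-\frac1{p_j^2}\right).$$ Theorem. For all $r,i$, the number $s_r(i)$ equals the largest size of a subset of $\{\alpha\in\{0,1,2\}^r:\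 p_1^{\alpha_1}\cdots p_r^{\alpha_r}\le i\}$ which, viewed as a subset of $\mathbb F_3^r$, contains no nontrivial three-term arithmetic progression. Moreover, there is a constant $c_{3,3}$ with $$0.6224\le c_{3,3}\le 0.6420$$ such that $f_{3,3}(n)=(c_{3,3}+o(1))\,n$ as $n\to\infty$, and $$c_{3,3}=\inf\{\gamma_r:\ r\ge 1\}=\sup\{\beta_r:\ r\ge 1\}.$$ -/

import Mathlib

open Filter Topology

noncomputable section

/-- A `k`-tuple `a` is a trivial solution of `a₁ ⋯ a_k = x ^ d` if the multiset of the `aᵢ` can be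
partitioned into `d`-tuples each consisting of `d` copies of the same number, i.e. if it is
`d` times some multiset `t`. -/
def IsTrivialSolution (k d : ℕ) (a : Fin k → ℕ) : Prop :=
  ∃ t : Multiset ℕ, Multiset.map a Finset.univ.val = d • t

/-- The equation `a₁ ⋯ a_k = x ^ d` has only trivial solutions with `a₁, …, a_k ∈ A` (not
necessarily distinct) and `x` an integer. -/
def OnlyTrivialSolutions (k d : ℕ) (A : Set ℕ) : Prop :=
  ∀ a : Fin k → ℕ, (∀ i, a i ∈ A) → (∃ x : ℤ, ∏ i, (a i : ℤ) = x ^ d) → IsTrivialSolution k d a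

open Classical in
/-- The largest size of a subset `A` of the finite set `X` such that `a₁ ⋯ a_k = x ^ d` has only
trivial solutions in `A`. -/
def maxSizeIn (k d : ℕ) (X : Finset ℕ) : ℕ :=
  (X.powerset.filter fun A : Finset ℕ => OnlyTrivialSolutions k d (A : Set ℕ)).sup Finset.card

/-- The function `f_{k,d}(n)`. -/
def extremalF (k d n : ℕ) : ℕ := maxSizeIn k d (Finset.Icc 1 n)

/-- The primes in increasing order, indexed from `0`: `nthPrime 0 = 2`, `nthPrime 1 = 3`, …;
the first `r` primes are `nthPrime j` for `j < r`. -/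
def nthPrime (j : ℕ) : ℕ := Nat.nth Nat.Prime j

/-- `p₁ ^ α₁ ⋯ p_r ^ α_r`, where the exponents are the representatives in `{0, 1, 2}` of
the coordinates of a vector in `F₃ ^ r`. -/
def smoothNumber (r : ℕ) (α : Fin r → ZMod 3) : ℕ := ∏ j : Fin r, nthPrime j ^ (α j).val

/-- The set `L_r(i)` of the numbers `p₁ ^ α₁ ⋯ p_r ^ α_r ≤ i` with all exponents in `{0, 1, 2}`. -/
def smoothCubefree (r i : ℕ) : Finset ℕ :=
  (Finset.univ.image (smoothNumber r)).filter (· ≤ i)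

/-- `s_r(i)`: the largest size of a subset of `L_r(i)` in which `a₁ a₂ a₃ = x ^ 3` has only trivial
solutions. -/
def smoothMax (r i : ℕ) : ℕ := maxSizeIn 3 3 (smoothCubefree r i)

open Classical in
/-- The largest size of a subset of `F₃ ^ r` that contains no nontrivial three-term arithmetic
progression and only contains exponent vectors `α` with `p₁ ^ α₁ ⋯ p_r ^ α_r ≤ i`. -/
def capMax (r i : ℕ) : ℕ :=
  ((Finset.univ.filter fun α : Fin r → ZMod 3 => smoothNumber r α ≤ i).powerset.filter
    fun S : Finset (Fin r → ZMod 3) => ThreeAPFree (S : Set (Fin r → ZMod 3))).sup Finset.card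

/-- `p₁² ⋯ p_r²`. -/
def primeSqProd (r : ℕ) : ℕ := ∏ j ∈ Finset.range r, nthPrime j ^ 2

/-- The upper bound `γ_r`. -/
def gammaBound (r : ℕ) : ℝ :=
  ((smoothMax r (primeSqProd r) : ℝ) / (primeSqProd r : ℝ) +
      ∑ i ∈ Finset.Icc 1 (primeSqProd r - 1), (smoothMax r i : ℝ) / ((i : ℝ) * ((i : ℝ) + 1))) *
    ∏ j ∈ Finset.range r, (1 - 1 / (nthPrime j : ℝ))

/-- The lower bound `β_r`, which is `γ_r` times the product of `1 - 1 / p²` over the primes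
`p > p_r`. -/
def betaBound (r : ℕ) : ℝ :=
  gammaBound r * ∏' j : ℕ, (1 - 1 / (nthPrime (r + j) : ℝ) ^ 2)

/-- The infinite product in `betaBound` converges. -/
theorem multipliable_primeTail (r : ℕ) :
    Multipliable fun j : ℕ => 1 - 1 / (nthPrime (r + j) : ℝ) ^ 2 := by
  have hinj : Function.Injective fun j : ℕ => nthPrime (r + j) := fun a b h =>
    Nat.add_left_cancel ((Nat.nth_injective Nat.infinite_setOfPred_prime) h)
  have h2 : Summable fun n : ℕ => 1 / (n : ℝ) ^ 2 :=
    Real.summable_one_div_nat_pow.mpr (by norm_num)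
  have h3 := (h2.comp_injective hinj).neg
  simpa [sub_eq_add_neg, Function.comp_def] using Real.multipliable_one_add_of_summable h3

end

/-!
Every positive integer is `k * u * w ^ 3` with `k` coprime to the first `r` primes and `u` a product
of these primes with exponents in `{0, 1, 2}`. For a set without nontrivial solutions the elements
with a given `k` have different `u ≤ n / k`, and these `u` again form a set without nontrivial
solutions. Hence `f(n) ≤ ∑ s_r(n / k)`, the sum over the `k ≤ n` coprime to the first `r` primes
(`extremalF_le_sum`). Conversely, the union of the sets `k * S`, with `k` squarefree and coprime to
the first `r` primes and `S` optimal in `L_r(n / k)`, has only trivial solutions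
(`sum_le_extremalF`): the part of a solution that is coprime to the first `r` primes is a cube, and
squarefree numbers whose product is a cube are equal. When the two sums are counted by the jumps of
the step function `s_r`, only the densities of sifted sets enter (`tendsto_card_sifted`), and the
bounds divided by `n` tend to `γ_r` and `β_r`. As `β_r / γ_r` is the product of `1 - 1 / p ^ 2` over
the primes `p > p_r`, which tends to `1`, the quotient `f(n) / n` converges to
`inf γ_r = sup β_r` (`exists_limit`).

A product of three numbers `u` is a cube iff the exponent vectors sum to zero over `F₃`, so that
`s_r(i)` is the size of a largest cap (`smoothMax_eq_capMax`). The numerical bounds are those of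
`r = 4`, with `6 / π ^ 2` as the product of `1 - 1 / p ^ 2` over all primes. The lower bounds for
`s_4(i)` come from explicit caps. The upper bounds for small `i` come from a branch-and-bound search
that the kernel evaluates (`capSearch`, `checkDolls`): it bounds a cap by its sections with nine
parallel planes, and by the bounds already verified for the tails of the list of points.

For large `i` the bound is the theorem that a cap in `F₃⁴` has at most twenty points
(`cap_card_le_twenty`). For a set of 21 points the mean over the nonzero linear forms of the sum of
the squares of the sizes of the three sections is `157.5`. Sections of a cap have at most nine
points, so for some form the sizes are `9, 9, 3` or `9, 8, 4`. In affine coordinates in which the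
first section contains the origin and three unit vectors, and the smallest section the fourth unit
vector, a search shows that already the sizes `9, 3, 8` are impossible.
-/

/-! ### Caps in `F₃⁴` coded by natural numbers -/

/-- The third point of the line through two points of `F₃`, on representatives in `{0, 1, 2}`. -/
def tritThird (a b : ℕ) : ℕ := Nat.mod (Nat.sub 6 (Nat.add (Nat.mod a 3) (Nat.mod b 3))) 3

/-- The third point of the line through two points of `F₃⁴`, where the point `(α₀, α₁, α₂, α₃)` is
coded by the number `α₀ + 3 α₁ + 9 α₂ + 27 α₃ < 81`. Here and in the search the operations on `ℕ`
are written without notation classes, because the kernel then evaluates them faster. -/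
def codeThird (a b : ℕ) : ℕ :=
  Nat.add (tritThird a b) (Nat.mul 3 (Nat.add (tritThird (Nat.div a 3) (Nat.div b 3)) (Nat.mul 3
    (Nat.add (tritThird (Nat.div a 9) (Nat.div b 9))
      (Nat.mul 3 (tritThird (Nat.div a 27) (Nat.div b 27)))))))

/-- A set of codes of points of `F₃⁴` no three of which form a line. -/
def IsCodeCap (S : Finset ℕ) : Prop :=
  (∀ a ∈ S, a < 81) ∧ ∀ a ∈ S, ∀ b ∈ S, a ≠ b → codeThird a b ∉ S

theorem IsCodeCap.mono {S T : Finset ℕ} (hS : IsCodeCap S) (h : T ⊆ S) : IsCodeCap T :=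
  ⟨fun a ha => hS.1 a (h ha), fun a ha b hb hab hc => hS.2 a (h ha) b (h hb) hab (h hc)⟩

/-! ### A verified branch-and-bound search -/

/-- Applies `f` to `n`; when the kernel evaluates it, `n` is reduced to a numeral first. -/
def forceNat (n : ℕ) (f : ℕ → Bool) : Bool := Nat.rec (f 0) (fun m _ => f (Nat.succ m)) n

@[simp] theorem forceNat_eq (n : ℕ) (f : ℕ → Bool) : forceNat n f = f n := by
  cases n <;> rfl

/-- A table with three binary digits for each set of points of `F₃²` (a bit mask below `512`):
the largest size of a cap in that set. -/
def planeTable : ℕ :=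
  0x9249249249249249249249239249249249239249239238da92492492492492492492391b9249249248db9238e39238da9249249249249249249238e392492492391b9248db9238da92492392391b9238e38da8da9248db91b6d28e369a6da6919249249249249249249248db9249249238e392391b9238da9249239248db92391b91b6d29238e38e369a8da8da6da6919249239238e39248db8e369a92391b8da8da91b6d26da6919238da9238da9238da6da6919238da6da6916da691491448

/-- The tabulated bound for the plane that starts at bit `k` of the mask `av`. -/
def planeCap (av k : ℕ) : ℕ :=
  Nat.land (Nat.shiftRight planeTable (Nat.mul 3 (Nat.land (Nat.shiftRight av k) 511))) 7

/-- The sum of the bounds for the three parallel planes of the hyperplane starting at bit `k`. -/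
def layerCap (av k : ℕ) : ℕ :=
  Nat.add (planeCap av k) (Nat.add (planeCap av (Nat.add k 9)) (planeCap av (Nat.add k 18)))

/-- An upper bound for the size of a cap contained in the set with bit mask `av`. -/
def capBound (av : ℕ) : ℕ :=
  Nat.add (layerCap av 0) (Nat.add (layerCap av 27) (layerCap av 54))

/-- Removes the elements of the mask `m` from the mask `av`. -/
def clearBits (av m : ℕ) : ℕ := Nat.xor av (Nat.land av m)

/-- The mask of the third points of the lines through `e` and the elements of a list. -/
def thirdMask (e : ℕ) : List ℕ → ℕ
  | [] => 0
  | c :: l => Nat.lor (Nat.shiftLeft 1 (codeThird e c)) (thirdMask e l)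

/-- Depth-first search for `need` further elements of a cap. The elements of the list are decided
one after the other; an entry `(e, r)` records the element `e` and a bound `r` for the number of
elements that a cap can have in the rest of the list, `e` included. The mask `av` holds the
undecided elements that are not yet excluded, `ch` the elements chosen so far, and `bnd` bounds in
terms of `av` what can still be gained. A choice of `need` elements is passed to the
continuation `k`; the value is `true` if every branch is pruned or accepted by `k`. -/
def capSearch (bnd : ℕ → ℕ) (k : ℕ → List ℕ → Bool) :
    List (ℕ × ℕ) → ℕ → ℕ → List ℕ → Bool
  | [], need, av, ch => bif Nat.beq need 0 then k av ch else true
  | (e, r) :: t, need, av, ch =>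
    bif Nat.beq need 0 then k av ch
    else bif Nat.beq (Nat.mod (Nat.shiftRight av e) 2) 1 then
      bif Nat.ble need r then
        bif Nat.ble need (bnd av) then
          (forceNat (clearBits av (Nat.lor (Nat.shiftLeft 1 e) (thirdMask e ch))) fun av' =>
            forceNat (Nat.sub need 1) fun need' => capSearch bnd k t need' av' (e :: ch)) &&
          forceNat (clearBits av (Nat.shiftLeft 1 e)) fun av' => capSearch bnd k t need av' ch
        else true
      else true
    else capSearch bnd k t need av ch

/-- The elements of a search list. -/
def itemSet (l : List (ℕ × ℕ)) : Finset ℕ := (l.map Prod.fst).toFinset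

/-- The mask of the elements of a search list. -/
def itemMask : List (ℕ × ℕ) → ℕ
  | [] => 0
  | (e, _) :: t => Nat.lor (Nat.shiftLeft 1 e) (itemMask t)

/-- The bound recorded in the first entry. -/
def headBound : List (ℕ × ℕ) → ℕ
  | [] => 0
  | (_, r) :: _ => r

/-- Verifies the bounds recorded in a search list, from the end of the list to its beginning: the
bound may stay the same only if a search finds no cap that contains the new element and attains
the previous bound on the others. -/
def checkDolls : List (ℕ × ℕ) → Bool
  | [] => true
  | (e, r) :: t =>
    checkDolls t && (Nat.ble (Nat.succ (headBound t)) r || (Nat.beq (headBound t) r &&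
      forceNat (itemMask t) fun av => forceNat (headBound t) fun n =>
        capSearch capBound (fun _ _ => false) t n av [e]))

/-- The bounds recorded in the list hold for the set `S`. -/
def DollsValid (S : Finset ℕ) : List (ℕ × ℕ) → Prop
  | [] => True
  | (e, r) :: t => (S ∩ itemSet ((e, r) :: t)).card ≤ r ∧ DollsValid S t

theorem testBit_iff_mod (m i : ℕ) : Nat.beq (Nat.mod (Nat.shiftRight m i) 2) 1 = m.testBit i := by
  have h : Nat.mod (Nat.shiftRight m i) 2 = m / 2 ^ i % 2 := by
    change (m >>> i) % 2 = _
    rw [Nat.shiftRight_eq_div_pow]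
  rw [h, Nat.testBit_eq_decide_div_mod_eq, Bool.eq_iff_iff, Nat.beq_eq, decide_eq_true_eq]

theorem testBit_clearBits (av m i : ℕ) :
    (clearBits av m).testBit i = (av.testBit i && !m.testBit i) := by
  have h : clearBits av m = av ^^^ (av &&& m) := rfl
  rw [h, Nat.testBit_xor, Nat.testBit_and]
  cases av.testBit i <;> cases m.testBit i <;> rfl

theorem testBit_lor (a b i : ℕ) : (Nat.lor a b).testBit i = (a.testBit i || b.testBit i) :=
  Nat.testBit_or a b i

theorem testBit_one_shiftLeft (e i : ℕ) : (Nat.shiftLeft 1 e).testBit i = decide (e = i) := by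
  change (1 <<< e).testBit i = _
  rw [Nat.one_shiftLeft, Nat.testBit_two_pow]

theorem testBit_thirdMask (e i : ℕ) (l : List ℕ) :
    (thirdMask e l).testBit i = true ↔ ∃ c ∈ l, codeThird e c = i := by
  induction l with
  | nil => simp [thirdMask]
  | cons c l ih =>
    rw [thirdMask, testBit_lor, testBit_one_shiftLeft, Bool.or_eq_true, ih]
    simp

theorem testBit_itemMask (i : ℕ) (l : List (ℕ × ℕ)) :
    (itemMask l).testBit i = true ↔ i ∈ itemSet l := by
  induction l with
  | nil => simp [itemMask, itemSet]
  | cons c l ih =>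
    obtain ⟨e, r⟩ := c
    simp only [itemMask, testBit_lor, testBit_one_shiftLeft, Bool.or_eq_true, decide_eq_true_eq, ih]
    simp [itemSet, eq_comm]

@[simp] theorem itemSet_cons (e r : ℕ) (t : List (ℕ × ℕ)) :
    itemSet ((e, r) :: t) = insert e (itemSet t) := by
  simp [itemSet]

@[simp] theorem itemSet_nil : itemSet [] = ∅ := rfl

/-- If the search succeeds and a cap `S` contains the chosen elements and at least `need` elements
of the list, then the continuation accepts some state that is compatible with `S`. The set `X`
holds the elements that are left to the continuation. -/
theorem capSearch_sound {S : Finset ℕ} (hS : IsCodeCap S) (X : Finset ℕ) (bnd : ℕ → ℕ)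
    (k : ℕ → List ℕ → Bool) (items : List (ℕ × ℕ)) (hnd : (items.map Prod.fst).Nodup)
    (hX : Disjoint X (itemSet items)) (hd : DollsValid S items)
    (hb : ∀ T ⊆ itemSet items, ∀ av : ℕ, (∀ x ∈ S, x ∈ T ∪ X → av.testBit x = true) →
      (S ∩ T).card ≤ bnd av)
    (need av : ℕ) (ch : List ℕ) (hch : ∀ c ∈ ch, c ∈ S) (hci : ∀ c ∈ ch, c ∉ itemSet items)
    (hav : ∀ x ∈ S, x ∈ itemSet items ∪ X → av.testBit x = true)
    (hneed : need ≤ (S ∩ itemSet items).card)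
    (hs : capSearch bnd k items need av ch = true) :
    ∃ av' ch', k av' ch' = true ∧ (∀ c ∈ ch', c ∈ S) ∧ (∀ c ∈ ch', c ∉ X ∨ c ∈ ch) ∧
      ∀ x ∈ S, x ∈ X → av'.testBit x = true := by
  induction items generalizing need av ch with
  | nil =>
    simp only [itemSet_nil, Finset.inter_empty, Finset.card_empty] at hneed
    obtain rfl : need = 0 := by omega
    refine ⟨av, ch, by simpa [capSearch] using hs, hch, fun c hc => Or.inr hc, fun x hx hx' => hav x hx ?_⟩
    simp [hx']
  | cons p t ih =>
    obtain ⟨e, r⟩ := p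
    simp only [capSearch, forceNat_eq] at hs
    by_cases h0 : need = 0
    · subst h0
      refine ⟨av, ch, by simpa using hs, hch, fun c hc => Or.inr hc, fun x hx hx' => hav x hx ?_⟩
      simp [hx']
    have h0' : Nat.beq need 0 = false := by
      rw [← Bool.not_eq_true, Nat.beq_eq]; exact h0
    have hr : Nat.ble need r = true := Nat.ble_eq_true_of_le (hneed.trans hd.1)
    have hbn : Nat.ble need (bnd av) = true :=
      Nat.ble_eq_true_of_le (hneed.trans (hb _ (Finset.Subset.refl _) av hav))
    simp only [h0', hr, hbn, cond_false, cond_true, testBit_iff_mod] at hs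
    simp only [List.map_cons, List.nodup_cons] at hnd
    have het : e ∉ itemSet t := by simpa [itemSet] using hnd.1
    rw [itemSet_cons, Finset.disjoint_insert_right] at hX
    have hb' : ∀ T ⊆ itemSet t, ∀ av : ℕ, (∀ x ∈ S, x ∈ T ∪ X → av.testBit x = true) →
        (S ∩ T).card ≤ bnd av := fun T hT =>
      hb T (hT.trans (by rw [itemSet_cons]; exact Finset.subset_insert _ _))
    have hne : ∀ x ∈ itemSet t ∪ X, x ≠ e := by
      rintro x hx rfl
      rcases Finset.mem_union.1 hx with hx | hx
      · exact het hx
      · exact hX.1 hx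
    have hsub : ∀ x ∈ itemSet t ∪ X, x ∈ itemSet ((e, r) :: t) ∪ X := by
      intro x hx
      rw [itemSet_cons, Finset.insert_union]
      exact Finset.mem_insert_of_mem hx
    have hci' : ∀ c ∈ ch, c ∉ itemSet t := fun c hc h =>
      hci c hc (by rw [itemSet_cons]; exact Finset.mem_insert_of_mem h)
    by_cases heS : e ∈ S
    · have hav_e : av.testBit e = true := hav e heS (by simp)
      rw [hav_e, cond_true, Bool.and_eq_true] at hs
      have hcard : (S ∩ itemSet ((e, r) :: t)).card = (S ∩ itemSet t).card + 1 := by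
        rw [itemSet_cons, Finset.inter_insert_of_mem heS, Finset.card_insert_of_notMem]
        simp [het]
      obtain ⟨av', ch', h1, h2, h3, h4⟩ := ih hnd.2 hX.2 hd.2 hb' _ _ _
        (by
          intro c hc
          rcases List.mem_cons.1 hc with rfl | hc
          · exact heS
          · exact hch c hc)
        (by
          intro c hc
          rcases List.mem_cons.1 hc with rfl | hc
          · exact het
          · exact hci' c hc)
        (by
          intro x hxS hx
          rw [testBit_clearBits, hav x hxS (hsub x hx), testBit_lor, testBit_one_shiftLeft]
          have h1 : (thirdMask e ch).testBit x = false := by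
            rw [← Bool.not_eq_true, testBit_thirdMask]
            rintro ⟨c, hc, rfl⟩
            have hec : e ≠ c := by
              rintro rfl
              exact hci _ hc (by simp)
            exact hS.2 e heS c (hch c hc) hec hxS
          simp [h1, (hne x hx).symm])
        (by
          change need - 1 ≤ _
          omega) hs.1
      refine ⟨av', ch', h1, h2, fun c hc => ?_, h4⟩
      rcases h3 c hc with h | h
      · exact Or.inl h
      · rcases List.mem_cons.1 h with rfl | h
        · exact Or.inl hX.1
        · exact Or.inr h
    · have hcard : (S ∩ itemSet ((e, r) :: t)).card = (S ∩ itemSet t).card := by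
        rw [itemSet_cons, Finset.inter_insert_of_notMem heS]
      cases hbit : av.testBit e with
      | false =>
        rw [hbit, cond_false] at hs
        exact ih hnd.2 hX.2 hd.2 hb' _ _ _ hch hci' (fun x hxS hx => hav x hxS (hsub x hx))
          (hcard ▸ hneed) hs
      | true =>
      rw [hbit, cond_true, Bool.and_eq_true] at hs
      exact ih hnd.2 hX.2 hd.2 hb' _ _ _ hch hci'
        (by
          intro x hxS hx
          rw [testBit_clearBits, hav x hxS (hsub x hx), testBit_one_shiftLeft]
          simp [(hne x hx).symm])
        (hcard ▸ hneed) hs.2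

/-! ### Caps in planes -/

/-- The tabulated value of a set that is a cap is at least its size. -/
theorem planeTable_self : ∀ m < 512,
    ((List.range 9).any fun a => (List.range 9).any fun b => decide (a ≠ b) && m.testBit a &&
      m.testBit b && m.testBit (codeThird a b)) = true ∨
    ((List.range 9).filter fun a => m.testBit a).length ≤ planeCap m 0 := by
  decide +kernel

theorem planeTable_mono : ∀ m < 512, ∀ i < 9, m.testBit i = true →
    clearBits m (2 ^ i) < m ∧ planeCap (clearBits m (2 ^ i)) 0 ≤ planeCap m 0 := by
  decide +kernel

theorem card_le_planeCap (m : ℕ) (hm : m < 512) (Q : Finset ℕ) (hQ : ∀ a ∈ Q, a < 9)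
    (hcap : ∀ a ∈ Q, ∀ b ∈ Q, a ≠ b → codeThird a b ∉ Q)
    (hbits : ∀ a ∈ Q, m.testBit a = true) : Q.card ≤ planeCap m 0 := by
  induction m using Nat.strong_induction_on with
  | _ m ih =>
    by_cases hex : ∃ i < 9, m.testBit i = true ∧ i ∉ Q
    · obtain ⟨i, hi, him, hiQ⟩ := hex
      obtain ⟨hlt, hle⟩ := planeTable_mono m hm i hi him
      refine (ih _ hlt (hlt.trans hm) fun a ha => ?_).trans hle
      have hai : a ≠ i := fun h => hiQ (h ▸ ha)
      rw [testBit_clearBits, hbits a ha, Nat.testBit_two_pow]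
      simp [hai.symm]
    · push Not at hex
      rcases planeTable_self m hm with h | h
      · exfalso
        simp only [List.any_eq_true, List.mem_range, Bool.and_eq_true, decide_eq_true_eq] at h
        obtain ⟨a, ha, b, hb, ⟨⟨hab, hma⟩, hmb⟩, hmc⟩ := h
        have hc9 : codeThird a b < 9 := by
          have : ∀ a < 9, ∀ b < 9, codeThird a b < 9 := by decide
          exact this a ha b hb
        exact hcap a (hex a ha hma) b (hex b hb hmb) hab (hex _ hc9 hmc)
      · refine le_trans ?_ h
        have hsub : Q ⊆ ((List.range 9).filter fun a => m.testBit a).toFinset := by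
          intro a ha
          simp [hQ a ha, hbits a ha]
        exact (Finset.card_le_card hsub).trans (List.toFinset_card_le _)

theorem codeThird_plane : ∀ q < 9, ∀ a < 9, ∀ b < 9,
    codeThird (9 * q + a) (9 * q + b) = 9 * q + codeThird a b := by
  decide +kernel

theorem card_plane_le {S : Finset ℕ} (hS : IsCodeCap S) (av q : ℕ) (hq : q < 9)
    (hav : ∀ x ∈ S, av.testBit x = true) :
    (S.filter fun x => x / 9 = q).card ≤ planeCap av (9 * q) := by
  set Q := (Finset.range 9).filter fun a => 9 * q + a ∈ S with hQ
  have hcard : (S.filter fun x => x / 9 = q).card ≤ Q.card := by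
    refine Finset.card_le_card_of_injOn (fun x => x % 9) ?_ ?_
    · intro x hx
      simp only [Finset.coe_filter, Set.mem_ofPred_eq] at hx
      simp only [hQ, Finset.coe_filter, Finset.mem_range, Set.mem_ofPred_eq]
      refine ⟨Nat.mod_lt _ (by norm_num), ?_⟩
      have : 9 * q + x % 9 = x := by omega
      rw [this]; exact hx.1
    · intro x hx y hy hxy
      simp only [Finset.coe_filter, Set.mem_ofPred_eq] at hx hy
      simp only at hxy
      omega
  refine hcard.trans ?_
  have hm : (av >>> (9 * q)) &&& 511 < 512 := by
    have := Nat.and_le_right (n := av >>> (9 * q)) (m := 511)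
    omega
  have key := card_le_planeCap ((av >>> (9 * q)) &&& 511) hm Q
    (by intro a ha; simp only [hQ, Finset.mem_filter, Finset.mem_range] at ha; exact ha.1)
    (by
      intro a ha b hb hab hc
      simp only [hQ, Finset.mem_filter, Finset.mem_range] at ha hb hc
      refine hS.2 _ ha.2 _ hb.2 (by omega) ?_
      rw [codeThird_plane q hq a ha.1 b hb.1]
      exact hc.2)
    (by
      intro a ha
      simp only [hQ, Finset.mem_filter, Finset.mem_range] at ha
      have h511 : ∀ a < 9, Nat.testBit 511 a = true := by decide
      rw [Nat.testBit_and, Nat.testBit_shiftRight, hav _ ha.2, h511 a ha.1]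
      rfl)
  have heq : planeCap ((av >>> (9 * q)) &&& 511) 0 = planeCap av (9 * q) := by
    change (planeTable >>> (3 * ((((av >>> (9 * q)) &&& 511) >>> 0) &&& 511))) &&& 7 =
      (planeTable >>> (3 * ((av >>> (9 * q)) &&& 511))) &&& 7
    rw [Nat.shiftRight_zero, Nat.and_assoc, Nat.and_self]
  exact heq ▸ key

theorem card_layer_le {S : Finset ℕ} (hS : IsCodeCap S) (av l : ℕ) (hl : l < 3)
    (hSl : ∀ x ∈ S, x / 27 = l) (hav : ∀ x ∈ S, av.testBit x = true) :
    S.card ≤ layerCap av (27 * l) := by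
  have h := Finset.card_eq_sum_card_fiberwise (f := fun x => x / 9) (s := S)
    (t := {3 * l, 3 * l + 1, 3 * l + 2}) (by
      intro x hx
      have := hSl x hx
      simp only [Finset.coe_insert, Finset.coe_singleton, Set.mem_insert_iff,
        Set.mem_singleton_iff]
      omega)
  rw [h, Finset.sum_insert (by simp), Finset.sum_insert (by simp), Finset.sum_singleton]
  have h0 := card_plane_le hS av (3 * l) (by omega) hav
  have h1 := card_plane_le hS av (3 * l + 1) (by omega) hav
  have h2 := card_plane_le hS av (3 * l + 2) (by omega) hav
  have e0 : 9 * (3 * l) = 27 * l := by ring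
  have e1 : 9 * (3 * l + 1) = 27 * l + 9 := by ring
  have e2 : 9 * (3 * l + 2) = 27 * l + 18 := by ring
  rw [e0] at h0; rw [e1] at h1; rw [e2] at h2
  exact add_le_add h0 (add_le_add h1 h2)

theorem card_le_capBound {S : Finset ℕ} (hS : IsCodeCap S) (av : ℕ)
    (hav : ∀ x ∈ S, av.testBit x = true) : S.card ≤ capBound av := by
  have h := Finset.card_eq_sum_card_fiberwise (f := fun x => x / 27) (s := S)
    (t := {0, 1, 2}) (by
      intro x hx
      have := hS.1 x hx
      simp only [Finset.coe_insert, Finset.coe_singleton, Set.mem_insert_iff,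
        Set.mem_singleton_iff]
      omega)
  rw [h, Finset.sum_insert (by simp), Finset.sum_insert (by simp), Finset.sum_singleton]
  have hl : ∀ l < 3, (S.filter fun x => x / 27 = l).card ≤ layerCap av (27 * l) := fun l hl =>
    card_layer_le (hS.mono (Finset.filter_subset _ _)) av l hl
      (fun x hx => (Finset.mem_filter.1 hx).2) fun x hx => hav x (Finset.mem_filter.1 hx).1
  exact add_le_add (hl 0 (by norm_num)) (add_le_add (hl 1 (by norm_num)) (hl 2 (by norm_num)))

/-- A successful check proves the recorded bounds for every cap. -/
theorem checkDolls_sound {S : Finset ℕ} (hS : IsCodeCap S) (items : List (ℕ × ℕ))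
    (hnd : (items.map Prod.fst).Nodup) (h : checkDolls items = true) :
    DollsValid S items ∧ (S ∩ itemSet items).card ≤ headBound items := by
  induction items with
  | nil => simp [DollsValid]
  | cons p t ih =>
    obtain ⟨e, r⟩ := p
    simp only [checkDolls, forceNat_eq, Bool.and_eq_true, Bool.or_eq_true, Nat.ble_eq,
      Nat.beq_eq] at h
    simp only [List.map_cons, List.nodup_cons] at hnd
    have het : e ∉ itemSet t := by simpa [itemSet] using hnd.1
    obtain ⟨hd, hc⟩ := ih hnd.2 h.1
    have hmain : (S ∩ itemSet ((e, r) :: t)).card ≤ r := by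
      have h1 : (S ∩ itemSet ((e, r) :: t)).card ≤ (S ∩ itemSet t).card + 1 := by
        rw [itemSet_cons]
        by_cases heS : e ∈ S
        · rw [Finset.inter_insert_of_mem heS]; exact Finset.card_insert_le _ _
        · rw [Finset.inter_insert_of_notMem heS]; omega
      rcases h.2 with h2 | ⟨h2, h3⟩
      · exact h1.trans ((Nat.succ_le_succ hc).trans h2)
      · by_contra hcon
        have heS : e ∈ S := by
          by_contra heS
          rw [itemSet_cons, Finset.inter_insert_of_notMem heS] at hcon
          omega
        obtain ⟨_, _, hfalse, _⟩ := capSearch_sound hS ∅ capBound (fun _ _ => false) t hnd.2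
          (Finset.disjoint_empty_left _) hd
          (fun T _ av hav => card_le_capBound (hS.mono Finset.inter_subset_left) av fun x hx =>
            hav x (Finset.mem_inter.1 hx).1 (by simp [(Finset.mem_inter.1 hx).2]))
          (headBound t) (itemMask t) [e] (by simpa using heS) (by simpa using het)
          (fun x _ hx => (testBit_itemMask x t).2 (by simpa using hx)) (by omega) h3
        exact Bool.false_ne_true hfalse
    exact ⟨⟨hmain, hd⟩, hmain⟩

/-! ### Search lists for the exponent vectors of the small numbers -/

/-- The code of a point of `F₃⁴`. -/
def pointCode (v : Fin 4 → ZMod 3) : ℕ :=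
  (v 0).val + 3 * (v 1).val + 9 * (v 2).val + 27 * (v 3).val

/-- The codes of the exponent vectors of the numbers up to `1`, a search list with bounds that the
search confirms. In these lists the points come in decreasing order of the exponents of `7` and `5`,
and within a plane in decreasing order of the numbers: the hyperplane with exponent `0` of `7` is
by far the fullest, and once the others are decided few of its points are left. -/
def items1 : List (ℕ × ℕ) :=
  [(0, 1)]

theorem checkDolls_items1 : checkDolls items1 = true := by decide +kernel

/-- The codes of the exponent vectors of the numbers up to `2`. -/
def items2 : List (ℕ × ℕ) :=
  [(1, 2), (0, 1)]

theorem checkDolls_items2 : checkDolls items2 = true := by decide +kernel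

/-- The codes of the exponent vectors of the numbers up to `4`. -/
def items4 : List (ℕ × ℕ) :=
  [(2, 3), (3, 3), (1, 2), (0, 1)]

theorem checkDolls_items4 : checkDolls items4 = true := by decide +kernel

/-- The codes of the exponent vectors of the numbers up to `5`. -/
def items5 : List (ℕ × ℕ) :=
  [(9, 4), (2, 3), (3, 3), (1, 2), (0, 1)]

theorem checkDolls_items5 : checkDolls items5 = true := by decide +kernel

/-- The codes of the exponent vectors of the numbers up to `6`. -/
def items6 : List (ℕ × ℕ) :=
  [(9, 5), (4, 4), (2, 3), (3, 3), (1, 2), (0, 1)]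

theorem checkDolls_items6 : checkDolls items6 = true := by decide +kernel

/-- The codes of the exponent vectors of the numbers up to `9`. -/
def items9 : List (ℕ × ℕ) :=
  [(27, 6), (9, 5), (6, 4), (4, 4), (2, 3), (3, 3), (1, 2), (0, 1)]

theorem checkDolls_items9 : checkDolls items9 = true := by decide +kernel

/-- The codes of the exponent vectors of the numbers up to `13`. -/
def items13 : List (ℕ × ℕ) :=
  [(27, 7), (10, 6), (9, 5), (5, 4), (6, 4), (4, 4), (2, 3), (3, 3), (1, 2), (0, 1)]

theorem checkDolls_items13 : checkDolls items13 = true := by decide +kernel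

/-- The codes of the exponent vectors of the numbers up to `14`. -/
def items14 : List (ℕ × ℕ) :=
  [(28, 8), (27, 7), (10, 6), (9, 5), (5, 4), (6, 4), (4, 4), (2, 3), (3, 3), (1, 2), (0, 1)]

theorem checkDolls_items14 : checkDolls items14 = true := by decide +kernel

/-- The codes of the exponent vectors of the numbers up to `20`. -/
def items20 : List (ℕ × ℕ) :=
  [(28, 9), (27, 8), (11, 7), (12, 7), (10, 6), (9, 5), (7, 4), (5, 4), (6, 4), (4, 4), (2, 3),
   (3, 3), (1, 2), (0, 1)]

theorem checkDolls_items20 : checkDolls items20 = true := by decide +kernel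

/-- The codes of the exponent vectors of the numbers up to `24`. -/
def items24 : List (ℕ × ℕ) :=
  [(30, 10), (28, 9), (27, 8), (11, 7), (12, 7), (10, 6), (9, 5), (7, 4), (5, 4), (6, 4),
   (4, 4), (2, 3), (3, 3), (1, 2), (0, 1)]

theorem checkDolls_items24 : checkDolls items24 = true := by decide +kernel

/-- The codes of the exponent vectors of the numbers up to `29`. -/
def items29 : List (ℕ × ℕ) :=
  [(29, 11), (30, 11), (28, 10), (27, 9), (18, 8), (11, 7), (12, 7), (10, 6), (9, 5), (7, 4),
   (5, 4), (6, 4), (4, 4), (2, 3), (3, 3), (1, 2), (0, 1)]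

theorem checkDolls_items29 : checkDolls items29 = true := by decide +kernel

/-- The codes of the exponent vectors of the numbers up to `34`. -/
def items34 : List (ℕ × ℕ) :=
  [(29, 12), (30, 12), (28, 11), (27, 10), (18, 9), (13, 8), (11, 7), (12, 7), (10, 6), (9, 5),
   (7, 4), (5, 4), (6, 4), (4, 4), (2, 3), (3, 3), (1, 2), (0, 1)]

theorem checkDolls_items34 : checkDolls items34 = true := by decide +kernel

/-- The codes of the exponent vectors of the numbers up to `41`. -/
def items41 : List (ℕ × ℕ) :=
  [(36, 13), (29, 12), (30, 12), (28, 11), (27, 10), (18, 9), (13, 8), (11, 7), (12, 7),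
   (10, 6), (9, 5), (8, 4), (7, 4), (5, 4), (6, 4), (4, 4), (2, 3), (3, 3), (1, 2), (0, 1)]

theorem checkDolls_items41 : checkDolls items41 = true := by decide +kernel

/-- The codes of the exponent vectors of the numbers up to `59`. -/
def items59 : List (ℕ × ℕ) :=
  [(54, 14), (36, 14), (31, 13), (29, 12), (30, 12), (28, 11), (27, 10), (19, 9), (18, 9),
   (15, 8), (13, 8), (11, 7), (12, 7), (10, 6), (9, 5), (8, 4), (7, 4), (5, 4), (6, 4), (4, 4),
   (2, 3), (3, 3), (1, 2), (0, 1)]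

theorem checkDolls_items59 : checkDolls items59 = true := by decide +kernel

/-- The codes of the exponent vectors of the numbers up to `69`. -/
def items69 : List (ℕ × ℕ) :=
  [(54, 15), (36, 14), (33, 13), (31, 13), (29, 12), (30, 12), (28, 11), (27, 10), (19, 9),
   (18, 9), (14, 8), (15, 8), (13, 8), (11, 7), (12, 7), (10, 6), (9, 5), (8, 4), (7, 4),
   (5, 4), (6, 4), (4, 4), (2, 3), (3, 3), (1, 2), (0, 1)]

theorem checkDolls_items69 : checkDolls items69 = true := by decide +kernel

/-- The codes of the exponent vectors of the numbers up to `104`. -/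
def items104 : List (ℕ × ℕ) :=
  [(55, 16), (54, 16), (37, 15), (36, 14), (32, 13), (33, 13), (31, 13), (29, 12), (30, 12),
   (28, 11), (27, 10), (20, 9), (21, 9), (19, 9), (18, 9), (16, 8), (14, 8), (15, 8), (13, 8),
   (11, 7), (12, 7), (10, 6), (9, 5), (8, 4), (7, 4), (5, 4), (6, 4), (4, 4), (2, 3), (3, 3),
   (1, 2), (0, 1)]

theorem checkDolls_items104 : checkDolls items104 = true := by decide +kernel

/-- The codes of the exponent vectors of the numbers up to `174`. -/
def items174 : List (ℕ × ℕ) :=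
  [(57, 17), (55, 17), (54, 17), (38, 16), (39, 16), (37, 15), (36, 14), (34, 13), (32, 13),
   (33, 13), (31, 13), (29, 12), (30, 12), (28, 11), (27, 10), (22, 9), (20, 9), (21, 9),
   (19, 9), (18, 9), (16, 8), (14, 8), (15, 8), (13, 8), (11, 7), (12, 7), (10, 6), (9, 5),
   (8, 4), (7, 4), (5, 4), (6, 4), (4, 4), (2, 3), (3, 3), (1, 2), (0, 1)]

theorem checkDolls_items174 : checkDolls items174 = true := by decide +kernel

/-- The codes of the exponent vectors of the numbers up to `209`. -/
def items209 : List (ℕ × ℕ) :=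
  [(56, 18), (57, 18), (55, 18), (54, 18), (45, 17), (38, 16), (39, 16), (37, 15), (36, 14),
   (34, 13), (32, 13), (33, 13), (31, 13), (29, 12), (30, 12), (28, 11), (27, 10), (22, 9),
   (20, 9), (21, 9), (19, 9), (18, 9), (17, 8), (16, 8), (14, 8), (15, 8), (13, 8), (11, 7),
   (12, 7), (10, 6), (9, 5), (8, 4), (7, 4), (5, 4), (6, 4), (4, 4), (2, 3), (3, 3), (1, 2),
   (0, 1)]

theorem checkDolls_items209 : checkDolls items209 = true := by decide +kernel

/-- The codes of the exponent vectors of the numbers up to `293`. -/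
def items293 : List (ℕ × ℕ) :=
  [(63, 19), (56, 19), (57, 19), (55, 19), (54, 19), (45, 18), (40, 17), (38, 16), (39, 16),
   (37, 15), (36, 14), (35, 13), (34, 13), (32, 13), (33, 13), (31, 13), (29, 12), (30, 12),
   (28, 11), (27, 10), (24, 9), (22, 9), (20, 9), (21, 9), (19, 9), (18, 9), (17, 8), (16, 8),
   (14, 8), (15, 8), (13, 8), (11, 7), (12, 7), (10, 6), (9, 5), (8, 4), (7, 4), (5, 4),
   (6, 4), (4, 4), (2, 3), (3, 3), (1, 2), (0, 1)]

theorem checkDolls_items293 : checkDolls items293 = true := by decide +kernel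

@[simp] theorem nthPrime_zero : nthPrime 0 = 2 := Nat.nth_prime_zero_eq_two
@[simp] theorem nthPrime_one : nthPrime 1 = 3 := Nat.nth_prime_one_eq_three
@[simp] theorem nthPrime_two : nthPrime 2 = 5 := Nat.nth_prime_two_eq_five
@[simp] theorem nthPrime_three : nthPrime 3 = 7 := Nat.nth_prime_three_eq_seven

theorem smoothNumber_four (α : Fin 4 → ZMod 3) :
    smoothNumber 4 α = 2 ^ (α 0).val * 3 ^ (α 1).val * 5 ^ (α 2).val * 7 ^ (α 3).val := by
  simp [smoothNumber, Fin.prod_univ_four]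

theorem pointCode_lt (v : Fin 4 → ZMod 3) : pointCode v < 81 := by
  have h0 := ZMod.val_lt (v 0)
  have h1 := ZMod.val_lt (v 1)
  have h2 := ZMod.val_lt (v 2)
  have h3 := ZMod.val_lt (v 3)
  simp only [pointCode]
  omega

theorem pointCode_injective : Function.Injective pointCode := by
  intro v w h
  simp only [pointCode] at h
  have hv0 := ZMod.val_lt (v 0)
  have hv1 := ZMod.val_lt (v 1)
  have hv2 := ZMod.val_lt (v 2)
  have hv3 := ZMod.val_lt (v 3)
  have hw0 := ZMod.val_lt (w 0)
  have hw1 := ZMod.val_lt (w 1)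
  have hw2 := ZMod.val_lt (w 2)
  have hw3 := ZMod.val_lt (w 3)
  funext j
  apply ZMod.val_injective 3
  fin_cases j <;> simp only [Fin.zero_eta, Fin.mk_one, Fin.reduceFinMk] <;> omega

theorem tritThird_val : ∀ a b : ZMod 3, ∀ x y : ℕ, x % 3 = a.val → y % 3 = b.val →
    tritThird x y = (-a - b).val := by
  intro a b x y hx hy
  change (6 - (x % 3 + y % 3)) % 3 = _
  rw [hx, hy]
  clear hx hy
  revert a b
  decide

theorem codeThird_pointCode (a b : Fin 4 → ZMod 3) :
    codeThird (pointCode a) (pointCode b) = pointCode (-a - b) := by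
  have ha0 := ZMod.val_lt (a 0)
  have ha1 := ZMod.val_lt (a 1)
  have ha2 := ZMod.val_lt (a 2)
  have ha3 := ZMod.val_lt (a 3)
  have hb0 := ZMod.val_lt (b 0)
  have hb1 := ZMod.val_lt (b 1)
  have hb2 := ZMod.val_lt (b 2)
  have hb3 := ZMod.val_lt (b 3)
  have h0 : tritThird (pointCode a) (pointCode b) = ((-a - b) 0).val :=
    tritThird_val (a 0) (b 0) _ _ (by simp only [pointCode]; omega) (by simp only [pointCode]; omega)
  have h1 : tritThird (pointCode a / 3) (pointCode b / 3) = ((-a - b) 1).val :=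
    tritThird_val (a 1) (b 1) _ _ (by simp only [pointCode]; omega) (by simp only [pointCode]; omega)
  have h2 : tritThird (pointCode a / 9) (pointCode b / 9) = ((-a - b) 2).val :=
    tritThird_val (a 2) (b 2) _ _ (by simp only [pointCode]; omega) (by simp only [pointCode]; omega)
  have h3 : tritThird (pointCode a / 27) (pointCode b / 27) = ((-a - b) 3).val :=
    tritThird_val (a 3) (b 3) _ _ (by simp only [pointCode]; omega) (by simp only [pointCode]; omega)
  change tritThird _ _ + 3 * (tritThird (pointCode a / 3) (pointCode b / 3) +
    3 * (tritThird (pointCode a / 9) (pointCode b / 9) +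
      3 * tritThird (pointCode a / 27) (pointCode b / 27))) = _
  rw [h0, h1, h2, h3]
  simp only [pointCode]
  ring

/-- Over `F₃` a set has no nontrivial three-term progression iff it contains no three distinct
points with sum `0`. -/
theorem threeAPFree_iff_add_eq_zero {r : ℕ} {s : Set (Fin r → ZMod 3)} :
    ThreeAPFree s ↔ ∀ a ∈ s, ∀ b ∈ s, ∀ c ∈ s, a + b + c = 0 → a = b ∧ b = c := by
  have h3 : ∀ b : Fin r → ZMod 3, b + b = -b := by
    intro b
    funext j
    have : ∀ x : ZMod 3, x + x = -x := by decide
    exact this (b j)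
  constructor
  · intro h a ha b hb c hc habc
    have h1 : a = b := h ha hb hc (by rw [h3, ← sub_eq_zero, ← habc]; abel)
    have h2 : b = c := h hb hc ha (by rw [h3, ← sub_eq_zero, ← habc]; abel)
    exact ⟨h1, h2⟩
  · intro h a ha b hb c hc habc
    refine (h a ha b hb c hc ?_).1
    rw [h3] at habc
    rw [add_right_comm, habc, neg_add_cancel]

theorem isCodeCap_image {S : Finset (Fin 4 → ZMod 3)}
    (hS : ThreeAPFree (S : Set (Fin 4 → ZMod 3))) : IsCodeCap (S.image pointCode) := by
  rw [threeAPFree_iff_add_eq_zero] at hS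
  constructor
  · intro a ha
    obtain ⟨v, -, rfl⟩ := Finset.mem_image.1 ha
    exact pointCode_lt v
  · intro a ha b hb hab hc
    obtain ⟨v, hv, rfl⟩ := Finset.mem_image.1 ha
    obtain ⟨w, hw, rfl⟩ := Finset.mem_image.1 hb
    obtain ⟨u, hu, huc⟩ := Finset.mem_image.1 hc
    rw [codeThird_pointCode] at huc
    obtain rfl := pointCode_injective huc
    exact hab (congrArg pointCode (hS v hv w hw _ hu (by abel)).1)

/-- A verified search list that contains the codes of all exponent vectors of numbers up to `l`
bounds the caps in this set of vectors. -/
theorem card_le_headBound {S : Finset (Fin 4 → ZMod 3)}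
    (hS : ThreeAPFree (S : Set (Fin 4 → ZMod 3))) (l : ℕ) (hl : ∀ α ∈ S, smoothNumber 4 α ≤ l)
    (items : List (ℕ × ℕ)) (hnd : (items.map Prod.fst).Nodup) (hc : checkDolls items = true)
    (hcover : ∀ a b c d : Fin 3, 2 ^ (a : ℕ) * 3 ^ (b : ℕ) * 5 ^ (c : ℕ) * 7 ^ (d : ℕ) ≤ l →
      (a : ℕ) + 3 * b + 9 * c + 27 * d ∈ items.map Prod.fst) :
    S.card ≤ headBound items := by
  have h := (checkDolls_sound (isCodeCap_image hS) items hnd hc).2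
  rwa [Finset.inter_eq_left.2, Finset.card_image_of_injective _ pointCode_injective] at h
  intro x hx
  obtain ⟨v, hv, rfl⟩ := Finset.mem_image.1 hx
  have := hl v hv
  rw [smoothNumber_four] at this
  exact List.mem_toFinset.2 (hcover ⟨_, ZMod.val_lt _⟩ ⟨_, ZMod.val_lt _⟩ ⟨_, ZMod.val_lt _⟩
    ⟨_, ZMod.val_lt _⟩ this)

/-! ### Caps that contain a frame -/

/-- The mask of all codes outside `ch` that are not on a line through two elements of `ch`. -/
def freeMask (ch : List ℕ) : ℕ :=
  itemMask (((List.range 81).filter fun x => !ch.elem x &&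
    ch.all fun a => ch.all fun b => a == b || codeThird a b != x).map fun x => (x, 0))

/-- The codes in the hyperplane `α₃ = 0` except those of the frame, with void bounds. -/
def layerZero : List (ℕ × ℕ) :=
  [(2, 81), (4, 81), (5, 81), (6, 81), (7, 81), (8, 81), (10, 81), (11, 81), (12, 81),
   (13, 81), (14, 81), (15, 81), (16, 81), (17, 81), (18, 81), (19, 81), (20, 81), (21, 81),
   (22, 81), (23, 81), (24, 81), (25, 81), (26, 81)]

/-- The codes in the hyperplane `α₃ = 1` except that of the frame, with void bounds. -/
def layerOne : List (ℕ × ℕ) :=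
  [(28, 81), (29, 81), (30, 81), (31, 81), (32, 81), (33, 81), (34, 81), (35, 81), (36, 81),
   (37, 81), (38, 81), (39, 81), (40, 81), (41, 81), (42, 81), (43, 81), (44, 81), (45, 81),
   (46, 81), (47, 81), (48, 81), (49, 81), (50, 81), (51, 81), (52, 81), (53, 81)]

/-- The codes in the hyperplane `α₃ = 2`, with void bounds. -/
def layerTwo : List (ℕ × ℕ) :=
  [(54, 81), (55, 81), (56, 81), (57, 81), (58, 81), (59, 81), (60, 81), (61, 81), (62, 81),
   (63, 81), (64, 81), (65, 81), (66, 81), (67, 81), (68, 81), (69, 81), (70, 81), (71, 81),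
   (72, 81), (73, 81), (74, 81), (75, 81), (76, 81), (77, 81), (78, 81), (79, 81), (80, 81)]

theorem search_ten : capSearch (fun av => layerCap av 0) (fun _ _ => false)
    layerZero 6 (freeMask [9, 3, 1, 0]) [9, 3, 1, 0] = true := by
  decide +kernel

theorem search_nine_three_eight : capSearch (fun av => layerCap av 0)
    (fun av ch => capSearch (fun _ => 81)
      (fun av ch => capSearch (fun av => layerCap av 54) (fun _ _ => false) layerTwo 8 av ch)
      layerOne 2 av ch)
    layerZero 5 (freeMask [27, 9, 3, 1, 0]) [27, 9, 3, 1, 0] = true := by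
  decide +kernel

theorem testBit_freeMask {S : Finset ℕ} (hS : IsCodeCap S) (ch : List ℕ) (hch : ∀ c ∈ ch, c ∈ S)
    (x : ℕ) (hx : x ∈ S) (hxc : x ∉ ch) : (freeMask ch).testBit x = true := by
  rw [freeMask, testBit_itemMask, itemSet, List.mem_toFinset, List.map_map]
  simp only [Function.comp_def, List.map_id', List.mem_filter, List.mem_range, Bool.and_eq_true,
    Bool.not_eq_true', List.all_eq_true, Bool.or_eq_true, beq_iff_eq, bne_iff_ne]
  refine ⟨hS.1 x hx, by simpa using hxc, fun a ha b hb => ?_⟩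
  by_contra h
  push Not at h
  exact hS.2 a (hch a ha) b (hch b hb) h.1 (h.2 ▸ hx)

theorem dollsValid_of_forall {S : Finset ℕ} (items : List (ℕ × ℕ))
    (h : ∀ p ∈ items, S.card ≤ p.2) : DollsValid S items := by
  induction items with
  | nil => trivial
  | cons p t ih =>
    obtain ⟨e, r⟩ := p
    exact ⟨(Finset.card_le_card Finset.inter_subset_left).trans (h (e, r) List.mem_cons_self),
      ih fun p hp => h p (List.mem_cons_of_mem _ hp)⟩

theorem IsCodeCap.card_le {S : Finset ℕ} (hS : IsCodeCap S) : S.card ≤ 81 := by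
  have : S ⊆ Finset.range 81 := fun x hx => Finset.mem_range.2 (hS.1 x hx)
  simpa using Finset.card_le_card this

theorem itemSet_layerZero : itemSet layerZero = Finset.range 27 \ {0, 1, 3, 9} := by
  decide +kernel

theorem itemSet_layerOne : itemSet layerOne = Finset.Ico 27 54 \ {27} := by
  decide +kernel

theorem itemSet_layerTwo : itemSet layerTwo = Finset.Ico 54 81 := by
  decide +kernel

theorem card_le_layerCap {S : Finset ℕ} (hS : IsCodeCap S) (l : ℕ) (hl : l < 3) (T : Finset ℕ)
    (hT : ∀ x ∈ T, x / 27 = l) (av : ℕ) (hav : ∀ x ∈ S, x ∈ T → av.testBit x = true) :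
    (S ∩ T).card ≤ layerCap av (27 * l) :=
  card_layer_le (hS.mono Finset.inter_subset_left) av l hl
    (fun x hx => hT x (Finset.mem_inter.1 hx).2)
    fun x hx => hav x (Finset.mem_inter.1 hx).1 (Finset.mem_inter.1 hx).2

/-- A cap that contains the origin and three unit vectors of a hyperplane through them has at most
nine points in this hyperplane. -/
theorem card_layerZero_le {S : Finset ℕ} (hS : IsCodeCap S) (h0 : 0 ∈ S) (h1 : 1 ∈ S) (h3 : 3 ∈ S)
    (h9 : 9 ∈ S) : (S ∩ Finset.range 27).card ≤ 9 := by
  by_contra hcon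
  have hcard : 6 ≤ (S ∩ itemSet layerZero).card := by
    have h := Finset.le_card_sdiff {0, 1, 3, 9} (S ∩ Finset.range 27)
    rw [itemSet_layerZero, ← Finset.inter_sdiff_assoc]
    have : ({0, 1, 3, 9} : Finset ℕ).card = 4 := rfl
    omega
  obtain ⟨_, _, hfalse, _⟩ := capSearch_sound hS ∅ (fun av => layerCap av 0) (fun _ _ => false)
    layerZero (by decide +kernel) (Finset.disjoint_empty_left _)
    (dollsValid_of_forall _ fun p hp => by
      have : ∀ p ∈ layerZero, 81 ≤ p.2 := by decide +kernel
      exact hS.card_le.trans (this p hp))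
    (fun T hT av hav => card_le_layerCap hS 0 (by norm_num) T
      (fun x hx => by
        have := hT hx
        rw [itemSet_layerZero, Finset.mem_sdiff, Finset.mem_range] at this
        omega)
      av fun x hx hxT => hav x hx (by simp [hxT]))
    6 (freeMask [9, 3, 1, 0]) [9, 3, 1, 0] (by simp [h0, h1, h3, h9])
    (by rw [itemSet_layerZero]; simp)
    (fun x hxS hx => testBit_freeMask hS _ (by simp [h0, h1, h3, h9]) x hxS (by
      rw [Finset.union_empty, itemSet_layerZero] at hx
      simp only [Finset.mem_sdiff, Finset.mem_insert, Finset.mem_singleton] at hx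
      simp only [List.mem_cons, List.not_mem_nil, or_false]
      tauto))
    hcard search_ten
  exact Bool.false_ne_true hfalse

/-- No cap that contains the origin and the unit vectors meets the three hyperplanes `α₃ = 0, 1, 2`
in at least nine, three and eight points. -/
theorem not_nine_three_eight {S : Finset ℕ} (hS : IsCodeCap S) (h0 : 0 ∈ S) (h1 : 1 ∈ S)
    (h3 : 3 ∈ S) (h9 : 9 ∈ S) (h27 : 27 ∈ S) (hA : 9 ≤ (S ∩ Finset.range 27).card)
    (hC : 3 ≤ (S ∩ Finset.Ico 27 54).card) (hB : 8 ≤ (S ∩ Finset.Ico 54 81).card) : False := by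
  have hd : ∀ items : List (ℕ × ℕ), (∀ p ∈ items, 81 ≤ p.2) → DollsValid S items := fun items h =>
    dollsValid_of_forall _ fun p hp => hS.card_le.trans (h p hp)
  have hcA : 5 ≤ (S ∩ itemSet layerZero).card := by
    have h := Finset.le_card_sdiff {0, 1, 3, 9} (S ∩ Finset.range 27)
    rw [itemSet_layerZero, ← Finset.inter_sdiff_assoc]
    have : ({0, 1, 3, 9} : Finset ℕ).card = 4 := rfl
    omega
  have hcC : 2 ≤ (S ∩ itemSet layerOne).card := by
    have h := Finset.le_card_sdiff {27} (S ∩ Finset.Ico 27 54)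
    rw [itemSet_layerOne, ← Finset.inter_sdiff_assoc]
    have : ({27} : Finset ℕ).card = 1 := rfl
    omega
  have hcB : 8 ≤ (S ∩ itemSet layerTwo).card := by rwa [itemSet_layerTwo]
  have hch : ∀ c ∈ [27, 9, 3, 1, 0], c ∈ S := by simp [h0, h1, h3, h9, h27]
  obtain ⟨av, ch, hk, hchS, hchX, hav⟩ := capSearch_sound hS (itemSet layerOne ∪ itemSet layerTwo)
    (fun av => layerCap av 0) _ layerZero (by decide +kernel) (by decide +kernel)
    (hd _ (by decide +kernel))
    (fun T hT av hav => card_le_layerCap hS 0 (by norm_num) T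
      (fun x hx => by
        have := hT hx
        rw [itemSet_layerZero, Finset.mem_sdiff, Finset.mem_range] at this
        omega)
      av fun x hx hxT => hav x hx (Finset.mem_union_left _ hxT))
    5 (freeMask [27, 9, 3, 1, 0]) [27, 9, 3, 1, 0] hch (by decide +kernel)
    (fun x hxS hx => testBit_freeMask hS _ hch x hxS (by
      intro hx'
      have : ∀ c ∈ [27, 9, 3, 1, 0],
          c ∉ itemSet layerZero ∪ (itemSet layerOne ∪ itemSet layerTwo) := by decide +kernel
      exact this x hx' hx))
    hcA search_nine_three_eight
  have hchX' : ∀ c ∈ ch, c ∉ itemSet layerOne ∪ itemSet layerTwo := by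
    intro c hc
    rcases hchX c hc with h | h
    · exact h
    · have : ∀ c ∈ [27, 9, 3, 1, 0], c ∉ itemSet layerOne ∪ itemSet layerTwo := by decide +kernel
      exact this c h
  obtain ⟨av, ch, hk, hchS, hchX2, hav⟩ := capSearch_sound hS (itemSet layerTwo)
    (fun _ => 81) _ layerOne (by decide +kernel) (by decide +kernel)
    (hd _ (by decide +kernel))
    (fun T _ _ _ => (Finset.card_le_card Finset.inter_subset_left).trans hS.card_le)
    2 av ch hchS (fun c hc h => hchX' c hc (Finset.mem_union_left _ h)) hav hcC hk
  obtain ⟨_, _, hfalse, _⟩ := capSearch_sound hS ∅ (fun av => layerCap av 54) (fun _ _ => false)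
    layerTwo (by decide +kernel) (Finset.disjoint_empty_left _) (hd _ (by decide +kernel))
    (fun T hT av hav => card_le_layerCap hS 2 (by norm_num) T
      (fun x hx => by
        have := hT hx
        rw [itemSet_layerTwo, Finset.mem_Ico] at this
        omega)
      av fun x hx hxT => hav x hx (Finset.mem_union_left _ hxT))
    8 av ch hchS (fun c hc h => by
      rcases hchX2 c hc with h' | h'
      · exact h' h
      · exact hchX' c h' (Finset.mem_union_right _ h))
    (fun x hxS hx => hav x hxS (by simpa using hx)) hcB hk
  exact Bool.false_ne_true hfalse

/-! ### Caps in `F₃⁴` have at most twenty points -/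

theorem card_orthogonal (w : Fin 4 → ZMod 3) (hw : w ≠ 0) :
    (Finset.univ.filter fun u : Fin 4 → ZMod 3 => u ⬝ᵥ w = 0).card = 27 := by
  revert w
  decide +kernel

/-- The second moment of the sizes of the hyperplane sections of `S`. -/
theorem sum_card_section_sq (S : Finset (Fin 4 → ZMod 3)) :
    ∑ u : Fin 4 → ZMod 3, ∑ c : ZMod 3, (S.filter fun x => u ⬝ᵥ x = c).card ^ 2 =
      27 * S.card ^ 2 + 54 * S.card := by
  have h1 : ∀ u : Fin 4 → ZMod 3, ∑ c : ZMod 3, (S.filter fun x => u ⬝ᵥ x = c).card ^ 2 =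
      ∑ x ∈ S, ∑ y ∈ S, if u ⬝ᵥ (x - y) = 0 then 1 else 0 := by
    intro u
    have h2 : ∀ c : ZMod 3, (S.filter fun x => u ⬝ᵥ x = c).card ^ 2 =
        ∑ x ∈ S, ∑ y ∈ S, if u ⬝ᵥ x = c ∧ u ⬝ᵥ y = c then 1 else 0 := by
      intro c
      rw [sq, Finset.card_filter, Finset.sum_mul_sum]
      refine Finset.sum_congr rfl fun x _ => Finset.sum_congr rfl fun y _ => ?_
      by_cases hx : u ⬝ᵥ x = c <;> by_cases hy : u ⬝ᵥ y = c <;> simp [hx, hy]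
    simp only [h2]
    rw [Finset.sum_comm]
    refine Finset.sum_congr rfl fun x _ => ?_
    rw [Finset.sum_comm]
    refine Finset.sum_congr rfl fun y _ => ?_
    by_cases hxy : u ⬝ᵥ x = u ⬝ᵥ y
    · simp [hxy]
    · rw [if_neg (by rwa [dotProduct_sub, sub_eq_zero])]
      refine Finset.sum_eq_zero fun c _ => if_neg ?_
      rintro ⟨h, h'⟩
      exact hxy (h.trans h'.symm)
  simp only [h1]
  rw [Finset.sum_comm]
  have h3 : ∀ x ∈ S, ∑ u : Fin 4 → ZMod 3, ∑ y ∈ S, (if u ⬝ᵥ (x - y) = 0 then 1 else 0) =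
      27 * S.card + 54 := by
    intro x hx
    rw [Finset.sum_comm]
    have h4 : ∀ y ∈ S, ∑ u : Fin 4 → ZMod 3, (if u ⬝ᵥ (x - y) = 0 then 1 else 0) =
        27 + if x = y then 54 else 0 := by
      intro y _
      rw [← Finset.card_filter]
      by_cases hxy : x = y
      · subst hxy
        simp
      · rw [card_orthogonal _ (sub_ne_zero.2 hxy), if_neg hxy]
    rw [Finset.sum_congr rfl h4, Finset.sum_add_distrib, Finset.sum_ite_eq, if_pos hx]
    simp [mul_comm]
  rw [Finset.sum_congr rfl h3, Finset.sum_const, smul_eq_mul]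
  ring

/-- The preimage of a set without progressions under an injective affine map has none. -/
theorem ThreeAPFree.preimage_affine {S : Set (Fin 4 → ZMod 3)} (hS : ThreeAPFree S)
    (a : Fin 4 → ZMod 3) (g : (Fin 4 → ZMod 3) →+ (Fin 4 → ZMod 3))
    (W : Set (Fin 4 → ZMod 3)) (hW : Set.InjOn g W) :
    ThreeAPFree {y | y ∈ W ∧ a + g y ∈ S} := by
  rintro x ⟨hxW, hx⟩ y ⟨hyW, hy⟩ z ⟨hzW, hz⟩ hxyz
  refine hW hxW hyW (add_left_cancel (hS hx hy hz ?_))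
  have := congrArg g hxyz
  rw [map_add, map_add] at this
  rw [add_add_add_comm, this, add_add_add_comm]

/-- The linear map that sends the unit vectors to four given vectors. -/
def frameMap (d : Fin 4 → Fin 4 → ZMod 3) : (Fin 4 → ZMod 3) →+ (Fin 4 → ZMod 3) where
  toFun y := y 0 • d 0 + y 1 • d 1 + y 2 • d 2 + y 3 • d 3
  map_zero' := by simp
  map_add' x y := by
    simp only [Pi.add_apply, add_smul]
    abel

theorem frameMap_apply (d : Fin 4 → Fin 4 → ZMod 3) (y : Fin 4 → ZMod 3) :
    frameMap d y = y 0 • d 0 + y 1 • d 1 + y 2 • d 2 + y 3 • d 3 := rfl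

/-- A plane contains at most four points of a cap. -/
theorem card_plane_section_le {S : Finset (Fin 4 → ZMod 3)}
    (hS : ThreeAPFree (S : Set (Fin 4 → ZMod 3))) (a d₀ d₁ : Fin 4 → ZMod 3)
    (hd : ∀ s t : ZMod 3, s • d₀ + t • d₁ = 0 → s = 0 ∧ t = 0) :
    (S.filter fun x => ∃ s t : ZMod 3, x = a + (s • d₀ + t • d₁)).card ≤ 4 := by
  set g := frameMap ![d₀, d₁, 0, 0] with hg
  have hgy : ∀ y, g y = y 0 • d₀ + y 1 • d₁ := fun y => by simp [hg, frameMap_apply]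
  set T := Finset.univ.filter fun y : Fin 4 → ZMod 3 => (y 2 = 0 ∧ y 3 = 0) ∧ a + g y ∈ S with hT
  have hTfree : ThreeAPFree (T : Set (Fin 4 → ZMod 3)) := by
    have := hS.preimage_affine a g {y | y 2 = 0 ∧ y 3 = 0} (by
      intro x hx y hy hxy
      have h : g (x - y) = 0 := by rw [map_sub, hxy, sub_self]
      rw [hgy] at h
      obtain ⟨h0, h1⟩ := hd _ _ h
      rw [Pi.sub_apply, sub_eq_zero] at h0 h1
      funext j
      fin_cases j
      · exact h0
      · exact h1
      · exact hx.1.trans hy.1.symm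
      · exact hx.2.trans hy.2.symm)
    simpa [hT] using this
  have hcap := isCodeCap_image hTfree
  have h9 : ∀ c ∈ T.image pointCode, c < 9 := by
    intro c hc
    obtain ⟨y, hy, rfl⟩ := Finset.mem_image.1 hc
    simp only [hT, Finset.mem_filter] at hy
    have h0 := ZMod.val_lt (y 0)
    have h1 := ZMod.val_lt (y 1)
    simp only [pointCode, hy.2.1.1, hy.2.1.2, ZMod.val_zero]
    omega
  have hle := card_le_planeCap 511 (by norm_num) _ h9 hcap.2 (by
    intro c hc
    have : ∀ a < 9, Nat.testBit 511 a = true := by decide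
    exact this c (h9 c hc))
  rw [Finset.card_image_of_injective _ pointCode_injective] at hle
  have h511 : planeCap 511 0 = 4 := by decide +kernel
  have hsub : (S.filter fun x => ∃ s t : ZMod 3, x = a + (s • d₀ + t • d₁)) ⊆
      T.image fun y => a + g y := by
    intro x hx
    obtain ⟨hxS, s, t, rfl⟩ := Finset.mem_filter.1 hx
    refine Finset.mem_image.2 ⟨![s, t, 0, 0], ?_, ?_⟩
    · simp only [hT, Finset.mem_filter, Finset.mem_univ, true_and, hgy]
      simpa using hxS
    · simp [hgy]
  calc _ ≤ (T.image fun y => a + g y).card := Finset.card_le_card hsub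
    _ ≤ T.card := Finset.card_image_le
    _ ≤ 4 := hle.trans h511.le

/-- A cap with five points contains four points in general position. -/
theorem exists_frame {S : Finset (Fin 4 → ZMod 3)}
    (hS : ThreeAPFree (S : Set (Fin 4 → ZMod 3))) (h5 : 5 ≤ S.card) :
    ∃ a ∈ S, ∃ d₀ d₁ d₂ : Fin 4 → ZMod 3, a + d₀ ∈ S ∧ a + d₁ ∈ S ∧ a + d₂ ∈ S ∧
      ∀ s t z : ZMod 3, s • d₀ + t • d₁ + z • d₂ = 0 → s = 0 ∧ t = 0 ∧ z = 0 := by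
  obtain ⟨a, b, c, ha, hb, hc, hab, hac, hbc⟩ := Finset.two_lt_card_iff.1 (by omega : 2 < S.card)
  have hcases : ∀ s : ZMod 3, s = 0 ∨ s = 1 ∨ s = -1 := by decide
  have hno : c - a ≠ -(b - a) := by
    intro h
    refine hab (hS hb ha hc ?_).symm
    have : c = a - (b - a) := by rw [sub_eq_iff_eq_add'] at h; rw [h]; abel
    rw [this]; abel
  have hba : b - a ≠ 0 := sub_ne_zero.2 (Ne.symm hab)
  have hca : c - a ≠ 0 := sub_ne_zero.2 (Ne.symm hac)
  have hcb : c - a ≠ b - a := fun h => hbc (sub_left_injective h).symm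
  have hd : ∀ s t : ZMod 3, s • (b - a) + t • (c - a) = 0 → s = 0 ∧ t = 0 := by
    intro s t h
    rcases hcases s with rfl | rfl | rfl <;> rcases hcases t with rfl | rfl | rfl <;>
      simp only [zero_smul, one_smul, neg_smul, zero_add, add_zero, neg_eq_zero] at h
    · exact ⟨rfl, rfl⟩
    · exact absurd h hca
    · exact absurd h hca
    · exact absurd h hba
    · exact absurd (eq_neg_of_add_eq_zero_right h) hno
    · exact absurd (sub_eq_zero.1 ((sub_eq_add_neg _ _).trans h)).symm hcb
    · exact absurd h hba
    · exact absurd (neg_add_eq_zero.1 h).symm hcb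
    · rw [← neg_add, neg_eq_zero] at h
      exact absurd (eq_neg_of_add_eq_zero_right h) hno
  obtain ⟨e, he, hne⟩ : ∃ e ∈ S, ¬ ∃ s t : ZMod 3, e = a + (s • (b - a) + t • (c - a)) := by
    by_contra hcon
    push Not at hcon
    have h4 := card_plane_section_le hS a (b - a) (c - a) hd
    rw [Finset.filter_true_of_mem hcon] at h4
    omega
  refine ⟨a, ha, b - a, c - a, e - a, by simpa using hb, by simpa using hc, by simpa using he, ?_⟩
  intro s t z h
  rcases hcases z with rfl | rfl | rfl
  · simp only [zero_smul, add_zero] at h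
    exact ⟨(hd s t h).1, (hd s t h).2, rfl⟩
  · refine absurd ⟨-s, -t, ?_⟩ hne
    rw [one_smul] at h
    rw [neg_smul, neg_smul, ← neg_add, ← eq_neg_of_add_eq_zero_right h]
    abel
  · refine absurd ⟨s, t, ?_⟩ hne
    rw [neg_smul, one_smul, ← sub_eq_add_neg, sub_eq_zero] at h
    rw [h]
    abel

/-- Affine coordinates adapted to a hyperplane with five points of a cap: the hyperplane becomes
`α₃ = 0`, four of the points the origin and unit vectors, and a point `w` off the hyperplane the
last unit vector. -/
theorem exists_coordinates {S : Finset (Fin 4 → ZMod 3)}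
    (hS : ThreeAPFree (S : Set (Fin 4 → ZMod 3))) (u w : Fin 4 → ZMod 3) (c : ZMod 3)
    (hw : u ⬝ᵥ w ≠ c) (h5 : 5 ≤ (S.filter fun x => u ⬝ᵥ x = c).card) :
    ∃ S' : Finset ℕ, IsCodeCap S' ∧ 0 ∈ S' ∧ 1 ∈ S' ∧ 3 ∈ S' ∧ 9 ∈ S' ∧ (w ∈ S → 27 ∈ S') ∧
      ∀ l : ZMod 3, (S.filter fun x => u ⬝ᵥ x = c + l * (u ⬝ᵥ w - c)).card =
        (S' ∩ Finset.Ico (27 * l.val) (27 * l.val + 27)).card := by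
  obtain ⟨a, ha, d₀, d₁, d₂, h0, h1, h2, hd⟩ := exists_frame
    (hS.mono (Finset.coe_subset.2 (Finset.filter_subset (fun x => u ⬝ᵥ x = c) S))) h5
  simp only [Finset.mem_filter, dotProduct_add] at ha h0 h1 h2
  rw [ha.2, add_eq_left] at h0 h1 h2
  set g := frameMap ![d₀, d₁, d₂, w - a] with hg
  have hgy : ∀ y, g y = y 0 • d₀ + y 1 • d₁ + y 2 • d₂ + y 3 • (w - a) := fun y => by
    simp [hg, frameMap_apply]
  have hdw : u ⬝ᵥ (w - a) = u ⬝ᵥ w - c := by rw [dotProduct_sub, ha.2]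
  have hug : ∀ y, u ⬝ᵥ g y = y 3 * (u ⬝ᵥ w - c) := by
    intro y
    simp [hgy, dotProduct_add, dotProduct_smul, h0.2, h1.2, h2.2, hdw]
  have hinj : Function.Injective g := by
    rw [injective_iff_map_eq_zero]
    intro y hy
    have h3 : y 3 = 0 := by
      have := hug y
      rw [hy, dotProduct_zero, eq_comm, mul_eq_zero] at this
      exact this.resolve_right (sub_ne_zero.2 hw)
    rw [hgy, h3, zero_smul, add_zero] at hy
    obtain ⟨hy0, hy1, hy2⟩ := hd _ _ _ hy
    funext j
    fin_cases j
    · exact hy0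
    · exact hy1
    · exact hy2
    · exact h3
  have hbij : Function.Bijective fun y => a + g y :=
    Finite.injective_iff_bijective.1 fun x y hxy => hinj (add_left_cancel hxy)
  set T := Finset.univ.filter fun y : Fin 4 → ZMod 3 => a + g y ∈ S with hT
  have hTfree : ThreeAPFree (T : Set (Fin 4 → ZMod 3)) := by
    simpa [hT] using hS.preimage_affine a g Set.univ hinj.injOn
  have hmem : ∀ y, a + g y ∈ S → pointCode y ∈ T.image pointCode := fun y hy =>
    Finset.mem_image_of_mem _ (by simpa [hT] using hy)
  refine ⟨T.image pointCode, isCodeCap_image hTfree, ?_, ?_, ?_, ?_, ?_, ?_⟩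
  · exact hmem ![0, 0, 0, 0] (by simpa [hgy] using ha.1)
  · exact hmem ![1, 0, 0, 0] (by simpa [hgy] using h0.1)
  · exact hmem ![0, 1, 0, 0] (by simpa [hgy] using h1.1)
  · exact hmem ![0, 0, 1, 0] (by simpa [hgy] using h2.1)
  · intro hwS
    exact hmem ![0, 0, 0, 1] (by simpa [hgy] using hwS)
  · intro l
    have hcode : ∀ y : Fin 4 → ZMod 3,
        pointCode y ∈ Finset.Ico (27 * l.val) (27 * l.val + 27) ↔ y 3 = l := by
      intro y
      have e0 := ZMod.val_lt (y 0)
      have e1 := ZMod.val_lt (y 1)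
      have e2 := ZMod.val_lt (y 2)
      rw [← (ZMod.val_injective 3).eq_iff, Finset.mem_Ico]
      simp only [pointCode]
      omega
    have hset : T.image pointCode ∩ Finset.Ico (27 * l.val) (27 * l.val + 27) =
        (T.filter fun y => y 3 = l).image pointCode := by
      ext x
      simp only [Finset.mem_inter, Finset.mem_image, Finset.mem_filter]
      constructor
      · rintro ⟨⟨y, hy, rfl⟩, hx⟩
        exact ⟨y, ⟨hy, (hcode y).1 hx⟩, rfl⟩
      · rintro ⟨y, ⟨hy, hl⟩, rfl⟩
        exact ⟨⟨y, hy, rfl⟩, (hcode y).2 hl⟩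
    rw [hset, Finset.card_image_of_injective _ pointCode_injective]
    symm
    refine Finset.card_bij (fun y _ => a + g y) ?_ ?_ ?_
    · intro y hy
      simp only [hT, Finset.mem_filter, Finset.mem_univ, true_and] at hy
      rw [Finset.mem_filter, dotProduct_add, hug, ha.2, hy.2]
      exact ⟨hy.1, rfl⟩
    · intro x _ y _ hxy
      exact hbij.1 hxy
    · intro x hx
      obtain ⟨y, rfl⟩ := hbij.2 x
      refine ⟨y, ?_, rfl⟩
      simp only [Finset.mem_filter, dotProduct_add, hug, ha.2] at hx
      have := mul_right_cancel₀ (sub_ne_zero.2 hw) (add_left_cancel hx.2)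
      simpa [hT, this] using hx.1

theorem card_hyperplane_section_le {S : Finset (Fin 4 → ZMod 3)}
    (hS : ThreeAPFree (S : Set (Fin 4 → ZMod 3))) (u : Fin 4 → ZMod 3) (hu : u ≠ 0) (c : ZMod 3) :
    (S.filter fun x => u ⬝ᵥ x = c).card ≤ 9 := by
  by_contra hcon
  obtain ⟨w, hw⟩ : ∃ w, u ⬝ᵥ w ≠ c := by
    obtain ⟨j, hj⟩ := Function.ne_iff.1 hu
    by_cases hc : c = 0
    · exact ⟨Pi.single j 1, by simpa [hc] using hj⟩
    · exact ⟨0, by simpa using Ne.symm hc⟩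
  obtain ⟨S', hS', h0, h1, h3, h9, -, hl⟩ := exists_coordinates hS u w c hw (by omega)
  have h := hl 0
  rw [zero_mul, add_zero] at h
  have hle := card_layerZero_le hS' h0 h1 h3 h9
  rw [Finset.range_eq_Ico] at hle
  simp only [ZMod.val_zero, mul_zero, zero_add] at h
  omega

theorem cap_card_le_twenty {S : Finset (Fin 4 → ZMod 3)}
    (hS : ThreeAPFree (S : Set (Fin 4 → ZMod 3))) : S.card ≤ 20 := by
  by_contra hcon
  obtain ⟨S, hSS, hcard⟩ := Finset.exists_subset_card_eq (show 21 ≤ S.card by omega)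
  replace hS : ThreeAPFree (S : Set (Fin 4 → ZMod 3)) := hS.mono (by simpa using hSS)
  set N := fun (u : Fin 4 → ZMod 3) (c : ZMod 3) => (S.filter fun x => u ⬝ᵥ x = c).card with hN
  -- The average of the second moment over the 80 nonzero functionals is 157.5.
  obtain ⟨u, hu, hu158⟩ : ∃ u ≠ 0, 158 ≤ ∑ c, N u c ^ 2 := by
    by_contra h
    push Not at h
    have h1 := sum_card_section_sq S
    rw [hcard, ← Finset.add_sum_erase _ _ (Finset.mem_univ 0)] at h1
    have h2 : ∑ c : ZMod 3, (S.filter fun x => (0 : Fin 4 → ZMod 3) ⬝ᵥ x = c).card ^ 2 = 441 := by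
      rw [Finset.sum_eq_single 0]
      · simp [hcard]
      · intro c _ hc
        simp [Ne.symm hc]
      · simp
    have h3 : ∑ u ∈ Finset.univ.erase (0 : Fin 4 → ZMod 3), ∑ c, N u c ^ 2 ≤
        (Finset.univ.erase (0 : Fin 4 → ZMod 3)).card • 157 :=
      Finset.sum_le_card_nsmul _ _ _ fun u hu => by
        have := h u (Finset.ne_of_mem_erase hu)
        omega
    have h4 : (Finset.univ.erase (0 : Fin 4 → ZMod 3)).card = 80 := by
      rw [Finset.card_erase_of_mem (Finset.mem_univ _)]
      simp
    rw [h4] at h3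
    rw [h2] at h1
    rw [smul_eq_mul] at h3
    change 441 + ∑ u ∈ Finset.univ.erase (0 : Fin 4 → ZMod 3), ∑ c, N u c ^ 2 = _ at h1
    omega
  have h9 : ∀ c, N u c ≤ 9 := card_hyperplane_section_le hS u hu
  have hsum : N u 0 + N u 1 + N u 2 = 21 := by
    rw [← hcard, Finset.card_eq_sum_card_fiberwise (f := fun x => u ⬝ᵥ x) (t := Finset.univ)
      (by simp)]
    exact (Fin.sum_univ_three _).symm
  have hsq : 158 ≤ N u 0 ^ 2 + N u 1 ^ 2 + N u 2 ^ 2 := hu158.trans_eq (Fin.sum_univ_three _)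
  -- Then the sizes are 9, 9, 3 or 9, 8, 4.
  obtain ⟨c₀, c₁, c₂, h01, h2, hA, hC, hB⟩ : ∃ c₀ c₁ c₂ : ZMod 3, c₁ ≠ c₀ ∧
      c₂ = c₀ + 2 * (c₁ - c₀) ∧ 9 ≤ N u c₀ ∧ 3 ≤ N u c₁ ∧ 8 ≤ N u c₂ := by
    have key : ∀ a b c : Fin 10, (a + b + c : ℕ) = 21 → 158 ≤ (a ^ 2 + b ^ 2 + c ^ 2 : ℕ) →
        (9 ≤ (a : ℕ) ∧ 3 ≤ (b : ℕ) ∧ 8 ≤ (c : ℕ)) ∨ (9 ≤ (a : ℕ) ∧ 3 ≤ (c : ℕ) ∧ 8 ≤ (b : ℕ)) ∨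
        (9 ≤ (b : ℕ) ∧ 3 ≤ (a : ℕ) ∧ 8 ≤ (c : ℕ)) ∨ (9 ≤ (b : ℕ) ∧ 3 ≤ (c : ℕ) ∧ 8 ≤ (a : ℕ)) ∨
        (9 ≤ (c : ℕ) ∧ 3 ≤ (a : ℕ) ∧ 8 ≤ (b : ℕ)) ∨
        (9 ≤ (c : ℕ) ∧ 3 ≤ (b : ℕ) ∧ 8 ≤ (a : ℕ)) := by
      decide +kernel
    rcases key ⟨_, Nat.lt_succ_of_le (h9 0)⟩ ⟨_, Nat.lt_succ_of_le (h9 1)⟩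
      ⟨_, Nat.lt_succ_of_le (h9 2)⟩ hsum hsq with h | h | h | h | h | h
    · exact ⟨0, 1, 2, by decide, by decide, h⟩
    · exact ⟨0, 2, 1, by decide, by decide, h⟩
    · exact ⟨1, 0, 2, by decide, by decide, h⟩
    · exact ⟨1, 2, 0, by decide, by decide, h⟩
    · exact ⟨2, 0, 1, by decide, by decide, h⟩
    · exact ⟨2, 1, 0, by decide, by decide, h⟩
  obtain ⟨w, hw⟩ : (S.filter fun x => u ⬝ᵥ x = c₁).Nonempty :=
    Finset.card_pos.1 (lt_of_lt_of_le (by norm_num) hC)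
  rw [Finset.mem_filter] at hw
  obtain ⟨S', hS', h0, h1, h3, h9', h27, hl⟩ := exists_coordinates hS u w c₀ (hw.2 ▸ h01)
    (le_trans (by norm_num) hA)
  rw [hw.2] at hl
  refine not_nine_three_eight hS' h0 h1 h3 h9' (h27 hw.1) ?_ ?_ ?_
  · have h := hl 0
    rw [zero_mul, add_zero] at h
    rw [Finset.range_eq_Ico]
    exact hA.trans_eq h
  · have h := hl 1
    rw [one_mul, add_sub_cancel] at h
    exact hC.trans_eq h
  · have h := hl 2
    rw [← h2] at h
    exact hB.trans_eq h

/-! ### Trivial solutions and exponent vectors -/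

theorem isTrivialSolution_three_iff (a : Fin 3 → ℕ) :
    IsTrivialSolution 3 3 a ↔ a 0 = a 1 ∧ a 1 = a 2 := by
  constructor
  · rintro ⟨t, ht⟩
    have hc := congrArg Multiset.card ht
    rw [Multiset.card_map, Multiset.card_nsmul] at hc
    have h1 : Multiset.card t = 1 := by
      have : Multiset.card (Finset.univ : Finset (Fin 3)).val = 3 := rfl
      omega
    obtain ⟨x, rfl⟩ := Multiset.card_eq_one.1 h1
    have hx : ∀ i, a i = x := by
      intro i
      have hi : a i ∈ Multiset.map a Finset.univ.val :=
        Multiset.mem_map_of_mem a (Finset.mem_univ i)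
      rw [ht] at hi
      exact Multiset.mem_singleton.1 (Multiset.mem_of_mem_nsmul hi)
    simp [hx]
  · rintro ⟨h0, h1⟩
    refine ⟨{a 0}, ?_⟩
    rw [Multiset.nsmul_singleton, Multiset.eq_replicate]
    refine ⟨rfl, fun b hb => ?_⟩
    obtain ⟨i, -, rfl⟩ := Multiset.mem_map.1 hb
    fin_cases i
    · rfl
    · exact h0.symm
    · exact (h0.trans h1).symm

theorem onlyTrivialSolutions_three_iff (A : Set ℕ) :
    OnlyTrivialSolutions 3 3 A ↔
      ∀ x ∈ A, ∀ y ∈ A, ∀ z ∈ A, (∃ m : ℕ, x * y * z = m ^ 3) → x = y ∧ y = z := by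
  constructor
  · rintro h x hx y hy z hz ⟨m, hm⟩
    have := h ![x, y, z] (by intro i; fin_cases i <;> assumption)
      ⟨m, by simp only [Fin.prod_univ_three]; exact_mod_cast hm⟩
    rw [isTrivialSolution_three_iff] at this
    exact this
  · rintro h a ha ⟨x, hx⟩
    rw [isTrivialSolution_three_iff]
    refine h _ (ha 0) _ (ha 1) _ (ha 2) ⟨x.natAbs, ?_⟩
    rw [Fin.prod_univ_three] at hx
    have := congrArg Int.natAbs hx
    rw [Int.natAbs_pow] at this
    rw [← this]
    simp [Int.natAbs_mul]

theorem prime_nthPrime (j : ℕ) : (nthPrime j).Prime := Nat.prime_nth_prime j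

theorem nthPrime_injective : Function.Injective nthPrime :=
  Nat.nth_injective Nat.infinite_setOfPred_prime

theorem exists_nthPrime_eq {p : ℕ} (hp : p.Prime) : ∃ j, nthPrime j = p :=
  ⟨_, Nat.nth_count hp⟩

theorem smoothNumber_pos (r : ℕ) (α : Fin r → ZMod 3) : 0 < smoothNumber r α :=
  Finset.prod_pos fun j _ => pow_pos (prime_nthPrime j).pos _

theorem factorization_smoothNumber (r : ℕ) (α : Fin r → ZMod 3) (i : Fin r) :
    (smoothNumber r α).factorization (nthPrime i) = (α i).val := by
  rw [smoothNumber, Nat.factorization_prod_apply (g := fun j : Fin r => nthPrime j ^ (α j).val)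
    fun j _ => pow_ne_zero _ (prime_nthPrime j).ne_zero, Finset.sum_eq_single i]
  · rw [(prime_nthPrime i).factorization_pow, Finsupp.single_eq_same]
  · intro j _ hj
    rw [(prime_nthPrime j).factorization_pow, Finsupp.single_eq_of_ne]
    exact fun h => hj (Fin.val_injective (nthPrime_injective h)).symm
  · simp

theorem smoothNumber_injective (r : ℕ) : Function.Injective (smoothNumber r) := by
  intro α β h
  funext j
  apply ZMod.val_injective 3
  rw [← factorization_smoothNumber, h, factorization_smoothNumber]

theorem three_dvd_val_iff (a b c : ZMod 3) : 3 ∣ a.val + b.val + c.val ↔ a + b + c = 0 := by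
  revert a b c
  decide

/-- The product of three numbers is a cube iff the exponent vectors sum to zero over `F₃`. -/
theorem smoothNumber_mul_eq_cube_iff (r : ℕ) (α β γ : Fin r → ZMod 3) :
    (∃ m : ℕ, smoothNumber r α * smoothNumber r β * smoothNumber r γ = m ^ 3) ↔
      α + β + γ = 0 := by
  constructor
  · rintro ⟨m, hm⟩
    funext j
    refine (three_dvd_val_iff _ _ _).1 ⟨m.factorization (nthPrime j), ?_⟩
    have h := congrArg (fun n => n.factorization (nthPrime j)) hm
    simp only [Nat.factorization_pow, Finsupp.smul_apply, smul_eq_mul] at h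
    rw [Nat.factorization_mul (mul_ne_zero (smoothNumber_pos _ _).ne' (smoothNumber_pos _ _).ne')
      (smoothNumber_pos _ _).ne', Nat.factorization_mul (smoothNumber_pos _ _).ne'
      (smoothNumber_pos _ _).ne'] at h
    simpa [factorization_smoothNumber] using h
  · intro h
    have h3 : ∀ j, 3 ∣ (α j).val + (β j).val + (γ j).val := fun j =>
      (three_dvd_val_iff _ _ _).2 (congrFun h j)
    choose q hq using h3
    refine ⟨∏ j : Fin r, nthPrime j ^ q j, ?_⟩
    rw [smoothNumber, smoothNumber, smoothNumber, ← Finset.prod_mul_distrib,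
      ← Finset.prod_mul_distrib, ← Finset.prod_pow]
    refine Finset.prod_congr rfl fun j _ => ?_
    rw [← pow_add, ← pow_add, hq, ← pow_mul, mul_comm]

theorem onlyTrivialSolutions_image_iff (r : ℕ) (S : Set (Fin r → ZMod 3)) :
    OnlyTrivialSolutions 3 3 (smoothNumber r '' S) ↔ ThreeAPFree S := by
  rw [onlyTrivialSolutions_three_iff, threeAPFree_iff_add_eq_zero]
  constructor
  · intro h a ha b hb c hc habc
    have := h _ (Set.mem_image_of_mem _ ha) _ (Set.mem_image_of_mem _ hb) _
      (Set.mem_image_of_mem _ hc) ((smoothNumber_mul_eq_cube_iff _ _ _ _).2 habc)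
    exact ⟨smoothNumber_injective r this.1, smoothNumber_injective r this.2⟩
  · rintro h _ ⟨a, ha, rfl⟩ _ ⟨b, hb, rfl⟩ _ ⟨c, hc, rfl⟩ hm
    obtain ⟨rfl, rfl⟩ := h a ha b hb c hc ((smoothNumber_mul_eq_cube_iff _ _ _ _).1 hm)
    exact ⟨rfl, rfl⟩

/-! ### The maxima as maxima -/

theorem card_le_maxSizeIn {k d : ℕ} {X A : Finset ℕ} (hAX : A ⊆ X)
    (hA : OnlyTrivialSolutions k d (A : Set ℕ)) : A.card ≤ maxSizeIn k d X := by
  classical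
  exact Finset.le_sup (f := Finset.card)
    (Finset.mem_filter.2 ⟨Finset.mem_powerset.2 hAX, hA⟩)

theorem exists_card_eq_maxSizeIn {k d : ℕ} (hk : k ≠ 0) (X : Finset ℕ) :
    ∃ A ⊆ X, OnlyTrivialSolutions k d (A : Set ℕ) ∧ A.card = maxSizeIn k d X := by
  classical
  have hne : (X.powerset.filter fun A : Finset ℕ =>
      OnlyTrivialSolutions k d (A : Set ℕ)).Nonempty := by
    refine ⟨∅, Finset.mem_filter.2 ⟨by simp, fun a ha => ?_⟩⟩
    exact absurd (ha ⟨0, Nat.pos_of_ne_zero hk⟩) (by simp)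
  obtain ⟨A, hA, h⟩ := Finset.exists_mem_eq_sup _ hne Finset.card
  rw [Finset.mem_filter, Finset.mem_powerset] at hA
  refine ⟨A, hA.1, hA.2, ?_⟩
  rw [← h, maxSizeIn]

theorem card_le_capMax {r i : ℕ} {S : Finset (Fin r → ZMod 3)}
    (hS : ThreeAPFree (S : Set (Fin r → ZMod 3))) (hi : ∀ α ∈ S, smoothNumber r α ≤ i) :
    S.card ≤ capMax r i := by
  classical
  refine Finset.le_sup (f := Finset.card)
    (Finset.mem_filter.2 ⟨Finset.mem_powerset.2 fun α hα => ?_, hS⟩)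
  exact Finset.mem_filter.2 ⟨Finset.mem_univ _, hi α hα⟩

theorem exists_card_eq_capMax (r i : ℕ) : ∃ S : Finset (Fin r → ZMod 3),
    ThreeAPFree (S : Set (Fin r → ZMod 3)) ∧ (∀ α ∈ S, smoothNumber r α ≤ i) ∧
      S.card = capMax r i := by
  classical
  have hne : ((Finset.univ.filter fun α : Fin r → ZMod 3 => smoothNumber r α ≤ i).powerset.filter
      fun S : Finset (Fin r → ZMod 3) => ThreeAPFree (S : Set (Fin r → ZMod 3))).Nonempty :=
    ⟨∅, by simp⟩
  obtain ⟨S, hS, h⟩ := Finset.exists_mem_eq_sup _ hne Finset.card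
  rw [Finset.mem_filter, Finset.mem_powerset] at hS
  refine ⟨S, hS.2, fun α hα => (Finset.mem_filter.1 (hS.1 hα)).2, ?_⟩
  rw [← h, capMax]

theorem smoothMax_eq_capMax (r i : ℕ) : smoothMax r i = capMax r i := by
  classical
  apply le_antisymm
  · obtain ⟨A, hAX, hA, hcard⟩ := exists_card_eq_maxSizeIn (k := 3) (d := 3) (by norm_num)
      (smoothCubefree r i)
    set S := Finset.univ.filter fun α : Fin r → ZMod 3 => smoothNumber r α ∈ A with hS
    have hSA : S.image (smoothNumber r) = A := by
      ext a
      simp only [hS, Finset.mem_image, Finset.mem_filter, Finset.mem_univ, true_and]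
      constructor
      · rintro ⟨α, hα, rfl⟩
        exact hα
      · intro ha
        have := hAX ha
        rw [smoothCubefree, Finset.mem_filter, Finset.mem_image] at this
        obtain ⟨⟨α, -, rfl⟩, -⟩ := this
        exact ⟨α, ha, rfl⟩
    change maxSizeIn 3 3 (smoothCubefree r i) ≤ _
    rw [← hcard, ← hSA, Finset.card_image_of_injective _ (smoothNumber_injective r)]
    refine card_le_capMax ?_ fun α hα => ?_
    · rwa [← onlyTrivialSolutions_image_iff, ← Finset.coe_image, hSA]
    · have := hAX ((Finset.mem_filter.1 hα).2)
      exact (Finset.mem_filter.1 this).2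
  · obtain ⟨S, hS, hi, hcard⟩ := exists_card_eq_capMax r i
    rw [← hcard, ← Finset.card_image_of_injective S (smoothNumber_injective r)]
    refine card_le_maxSizeIn (fun a ha => ?_) ?_
    · obtain ⟨α, hα, rfl⟩ := Finset.mem_image.1 ha
      exact Finset.mem_filter.2 ⟨Finset.mem_image_of_mem _ (Finset.mem_univ _), hi α hα⟩
    · rwa [Finset.coe_image, onlyTrivialSolutions_image_iff]

theorem smoothMax_mono (r : ℕ) : Monotone (smoothMax r) := by
  intro i j hij
  rw [smoothMax_eq_capMax, smoothMax_eq_capMax]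
  obtain ⟨S, hS, hi, hcard⟩ := exists_card_eq_capMax r i
  rw [← hcard]
  exact card_le_capMax hS fun α hα => (hi α hα).trans hij

/-! ### Combinatorial bounds for the extremal function -/

open Classical in
/-- The numbers in `[1, n]` divisible by none of `m 0, …, m (J - 1)`. -/
noncomputable def sifted (m : ℕ → ℕ) (J n : ℕ) : Finset ℕ :=
  (Finset.Icc 1 n).filter fun k => ∀ j < J, ¬ m j ∣ k

theorem mem_sifted {m : ℕ → ℕ} {J n k : ℕ} :
    k ∈ sifted m J n ↔ (1 ≤ k ∧ k ≤ n) ∧ ∀ j < J, ¬ m j ∣ k := by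
  simp [sifted]

/-- A positive integer is a product of a number coprime to the first `r` primes, a cubefree number
composed of the first `r` primes, and a cube. -/
theorem exists_eq_mul_smoothNumber_mul_cube (r a : ℕ) (ha : a ≠ 0) :
    ∃ k : ℕ, ∃ α : Fin r → ZMod 3, ∃ w : ℕ,
      a = k * smoothNumber r α * w ^ 3 ∧ ∀ j < r, ¬ nthPrime j ∣ k := by
  induction r with
  | zero => exact ⟨a, 0, 1, by simp [smoothNumber], by simp⟩
  | succ r ih =>
    obtain ⟨k, α, w, hk, hj⟩ := ih
    have hk0 : k ≠ 0 := by
      rintro rfl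
      simp [ha] at hk
    obtain ⟨v, k', hdvd, hv⟩ := Nat.exists_eq_pow_mul_and_not_dvd hk0 (nthPrime r)
      (prime_nthPrime r).ne_one
    refine ⟨k', Fin.snoc α ((v : ℕ) : ZMod 3), w * nthPrime r ^ (v / 3), ?_, ?_⟩
    · have hs : smoothNumber (r + 1) (Fin.snoc α ((v : ℕ) : ZMod 3)) =
          smoothNumber r α * nthPrime r ^ (v % 3) := by
        rw [smoothNumber, Fin.prod_univ_castSucc]
        simp [smoothNumber, ZMod.val_natCast]
      have hp : nthPrime r ^ v = nthPrime r ^ (v % 3) * (nthPrime r ^ (v / 3)) ^ 3 := by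
        rw [← pow_mul, ← pow_add]
        congr 1
        omega
      rw [hk, hs, hv, hp]
      ring
    · intro j hjr hd
      rcases Nat.lt_succ_iff_lt_or_eq.1 hjr with h | rfl
      · exact hj j h (hv ▸ hd.mul_left _)
      · exact hdvd hd

theorem extremalF_le_sum (r n : ℕ) :
    extremalF 3 3 n ≤ ∑ k ∈ sifted nthPrime r n, smoothMax r (n / k) := by
  classical
  obtain ⟨A, hAX, hA, hcard⟩ := exists_card_eq_maxSizeIn (k := 3) (d := 3) (by norm_num)
    (Finset.Icc 1 n)
  rw [onlyTrivialSolutions_three_iff] at hA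
  have hdec := fun a : ℕ => exists_eq_mul_smoothNumber_mul_cube r (max a 1) (by omega)
  choose K α W hKW hK using hdec
  have hdec' : ∀ a ∈ A, a = K a * smoothNumber r (α a) * W a ^ 3 := by
    intro a ha
    have h1 := (Finset.mem_Icc.1 (hAX ha)).1
    have := hKW a
    rwa [max_eq_left h1] at this
  have hpos : ∀ a ∈ A, 0 < K a ∧ 0 < W a := by
    intro a ha
    have h1 := (Finset.mem_Icc.1 (hAX ha)).1
    have h := hdec' a ha
    constructor <;> rw [Nat.pos_iff_ne_zero] <;> intro h0 <;> simp [h0] at h <;> omega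
  have hle : ∀ a ∈ A, K a * smoothNumber r (α a) ≤ n := by
    intro a ha
    calc K a * smoothNumber r (α a) ≤ K a * smoothNumber r (α a) * W a ^ 3 :=
          Nat.le_mul_of_pos_right _ (pow_pos (hpos a ha).2 3)
      _ = a := (hdec' a ha).symm
      _ ≤ n := (Finset.mem_Icc.1 (hAX ha)).2
  change maxSizeIn 3 3 (Finset.Icc 1 n) ≤ _
  rw [← hcard, Finset.card_eq_sum_card_fiberwise (f := K) (t := sifted nthPrime r n)]
  · refine Finset.sum_le_sum fun k hk => ?_
    -- On a fibre the cubefree smooth part is injective and preserves the equation.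
    have hinj : Set.InjOn (fun a => smoothNumber r (α a)) (A.filter fun a => K a = k) := by
      intro a ha b hb hab
      simp only [Finset.coe_filter, Set.mem_ofPred_eq] at ha hb hab
      refine (hA a ha.1 a ha.1 b hb.1
        ⟨k * smoothNumber r (α a) * (W a ^ 2 * W b), ?_⟩).2
      have ea := hdec' a ha.1
      have eb := hdec' b hb.1
      rw [ha.2] at ea
      rw [hb.2, ← hab] at eb
      calc a * a * b = (k * smoothNumber r (α a) * W a ^ 3) * (k * smoothNumber r (α a) * W a ^ 3) *
            (k * smoothNumber r (α a) * W b ^ 3) := by rw [← ea, ← eb]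
        _ = (k * smoothNumber r (α a) * (W a ^ 2 * W b)) ^ 3 := by ring
    rw [← Finset.card_image_of_injOn hinj]
    refine card_le_maxSizeIn ?_ ?_
    · intro u hu
      obtain ⟨a, ha, rfl⟩ := Finset.mem_image.1 hu
      obtain ⟨haA, rfl⟩ := Finset.mem_filter.1 ha
      refine Finset.mem_filter.2 ⟨Finset.mem_image_of_mem _ (Finset.mem_univ _), ?_⟩
      rw [Nat.le_div_iff_mul_le (hpos a haA).1, mul_comm]
      exact hle a haA
    · rw [onlyTrivialSolutions_three_iff]
      intro x hx y hy z hz hm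
      simp only [Finset.coe_image, Set.mem_image, Finset.coe_filter, Set.mem_ofPred_eq] at hx hy hz
      obtain ⟨a, ⟨haA, haK⟩, rfl⟩ := hx
      obtain ⟨b, ⟨hbA, hbK⟩, rfl⟩ := hy
      obtain ⟨c, ⟨hcA, hcK⟩, rfl⟩ := hz
      obtain ⟨m, hm⟩ := hm
      have ea := hdec' a haA
      have eb := hdec' b hbA
      have ec := hdec' c hcA
      rw [haK] at ea
      rw [hbK] at eb
      rw [hcK] at ec
      have := hA a haA b hbA c hcA ⟨k * m * (W a * W b * W c), by
        calc a * b * c = (k * smoothNumber r (α a) * W a ^ 3) *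
              (k * smoothNumber r (α b) * W b ^ 3) * (k * smoothNumber r (α c) * W c ^ 3) := by
              rw [← ea, ← eb, ← ec]
          _ = k ^ 3 * (smoothNumber r (α a) * smoothNumber r (α b) * smoothNumber r (α c)) *
              (W a * W b * W c) ^ 3 := by ring
          _ = (k * m * (W a * W b * W c)) ^ 3 := by rw [hm]; ring⟩
      exact ⟨by rw [this.1], by rw [this.2]⟩
  · intro a ha
    have h := hpos a ha
    have hs := smoothNumber_pos r (α a)
    refine Finset.mem_coe.2 (mem_sifted.2 ⟨⟨h.1, ?_⟩, hK a⟩)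
    exact (Nat.le_mul_of_pos_right _ hs).trans (hle a ha)

/-- The moduli that sieve out the multiples of the first `r` primes and of the squares of the
other primes. -/
noncomputable def sieveModulus (r j : ℕ) : ℕ := if j < r then nthPrime j else nthPrime j ^ 2

theorem sieveModulus_dvd_sq (r j : ℕ) : sieveModulus r j ∣ nthPrime j ^ 2 := by
  unfold sieveModulus
  split_ifs
  · exact dvd_pow_self _ two_ne_zero
  · exact dvd_rfl

open Classical in
/-- The squarefree numbers in `[1, n]` that are coprime to the first `r` primes. -/
noncomputable def squarefreeSifted (r n : ℕ) : Finset ℕ :=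
  (Finset.Icc 1 n).filter fun k => ∀ j, ¬ sieveModulus r j ∣ k

theorem mem_squarefreeSifted {r n k : ℕ} :
    k ∈ squarefreeSifted r n ↔ (1 ≤ k ∧ k ≤ n) ∧ ∀ j, ¬ sieveModulus r j ∣ k := by
  simp [squarefreeSifted]

theorem factorization_le_one_of_mem {r n k : ℕ} (hk : k ∈ squarefreeSifted r n) (p : ℕ) :
    k.factorization p ≤ 1 := by
  by_cases hp : p.Prime
  · obtain ⟨j, rfl⟩ := exists_nthPrime_eq hp
    by_contra h
    have hk' := mem_squarefreeSifted.1 hk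
    refine hk'.2 j ((sieveModulus_dvd_sq r j).trans ?_)
    exact (hp.pow_dvd_iff_le_factorization (by omega)).2 (by omega)
  · simp [Nat.factorization_eq_zero_of_not_prime k hp]

/-- Squarefree numbers whose product is a cube are equal. -/
theorem eq_of_mul_eq_cube {a b c m : ℕ} (ha : a ≠ 0) (hb : b ≠ 0) (hc : c ≠ 0)
    (ha1 : ∀ p, a.factorization p ≤ 1) (hb1 : ∀ p, b.factorization p ≤ 1)
    (hc1 : ∀ p, c.factorization p ≤ 1) (h : a * b * c = m ^ 3) : a = b ∧ b = c := by
  have key : ∀ p, a.factorization p + b.factorization p + c.factorization p =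
      3 * m.factorization p := by
    intro p
    have := congrArg (fun n => n.factorization p) h
    simp only [Nat.factorization_pow, Finsupp.smul_apply, smul_eq_mul] at this
    rwa [Nat.factorization_mul (mul_ne_zero ha hb) hc, Nat.factorization_mul ha hb] at this
  constructor
  · refine Nat.eq_of_factorization_eq ha hb fun p => ?_
    have := key p; have := ha1 p; have := hb1 p; have := hc1 p
    omega
  · refine Nat.eq_of_factorization_eq hb hc fun p => ?_
    have := key p; have := ha1 p; have := hb1 p; have := hc1 p
    omega

theorem coprime_smoothNumber {r n k : ℕ} (hk : k ∈ squarefreeSifted r n) (α : Fin r → ZMod 3) :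
    Nat.Coprime k (smoothNumber r α) := by
  refine Nat.Coprime.prod_right fun j _ => Nat.Coprime.pow_right _ ?_
  rw [Nat.coprime_comm, (prime_nthPrime j).coprime_iff_not_dvd]
  have := (mem_squarefreeSifted.1 hk).2 j
  rwa [sieveModulus, if_pos j.2] at this

theorem sum_le_extremalF (r n : ℕ) :
    ∑ k ∈ squarefreeSifted r n, smoothMax r (n / k) ≤ extremalF 3 3 n := by
  classical
  have hex := fun i => exists_card_eq_maxSizeIn (k := 3) (d := 3) (by norm_num)
    (smoothCubefree r i)
  choose S hSX hS hcard using hex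
  have hsm : ∀ i, ∀ u ∈ S i, ∃ α, smoothNumber r α = u ∧ u ≤ i := by
    intro i u hu
    have := Finset.mem_filter.1 (hSX i hu)
    obtain ⟨α, -, hα⟩ := Finset.mem_image.1 this.1
    exact ⟨α, hα, this.2⟩
  -- A product `k * u` determines its factor `k`.
  have huniq : ∀ k ∈ squarefreeSifted r n, ∀ l ∈ squarefreeSifted r n, ∀ u ∈ S (n / k),
      ∀ v ∈ S (n / l), k * u = l * v → k = l := by
    intro k hk l hl u hu v hv h
    obtain ⟨α, rfl, -⟩ := hsm _ _ hu
    obtain ⟨β, rfl, -⟩ := hsm _ _ hv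
    apply Nat.dvd_antisymm
    · exact (coprime_smoothNumber hk β).dvd_of_dvd_mul_right (h ▸ Nat.dvd_mul_right _ _)
    · exact (coprime_smoothNumber hl α).dvd_of_dvd_mul_right (h ▸ Nat.dvd_mul_right _ _)
  set A := (squarefreeSifted r n).biUnion fun k => (S (n / k)).image fun u => k * u with hA
  have hAcard : A.card = ∑ k ∈ squarefreeSifted r n, smoothMax r (n / k) := by
    rw [hA, Finset.card_biUnion]
    · refine Finset.sum_congr rfl fun k hk => ?_
      have hk0 : 0 < k := (mem_squarefreeSifted.1 hk).1.1
      rw [Finset.card_image_of_injective _ (mul_right_injective₀ hk0.ne'), hcard]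
      rfl
    · intro k hk l hl hkl
      change Disjoint _ _
      rw [Finset.disjoint_left]
      intro a ha hb
      obtain ⟨u, hu, rfl⟩ := Finset.mem_image.1 ha
      obtain ⟨v, hv, hv'⟩ := Finset.mem_image.1 hb
      exact hkl (huniq k hk l hl u hu v hv hv'.symm)
  rw [← hAcard]
  refine card_le_maxSizeIn ?_ ?_
  · intro a ha
    obtain ⟨k, hk, ha⟩ := Finset.mem_biUnion.1 ha
    obtain ⟨u, hu, rfl⟩ := Finset.mem_image.1 ha
    obtain ⟨α, rfl, hle⟩ := hsm _ _ hu
    have hk0 : 0 < k := (mem_squarefreeSifted.1 hk).1.1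
    rw [Nat.le_div_iff_mul_le hk0, mul_comm] at hle
    exact Finset.mem_Icc.2 ⟨Nat.mul_pos hk0 (smoothNumber_pos r α), hle⟩
  · rw [onlyTrivialSolutions_three_iff]
    intro x hx y hy z hz hm
    rw [Finset.mem_coe, hA, Finset.mem_biUnion] at hx hy hz
    obtain ⟨k, hk, hx⟩ := hx
    obtain ⟨l, hl, hy⟩ := hy
    obtain ⟨q, hq, hz⟩ := hz
    obtain ⟨u, hu, rfl⟩ := Finset.mem_image.1 hx
    obtain ⟨v, hv, rfl⟩ := Finset.mem_image.1 hy
    obtain ⟨w, hw, rfl⟩ := Finset.mem_image.1 hz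
    obtain ⟨α, hα, -⟩ := hsm _ _ hu
    obtain ⟨β, hβ, -⟩ := hsm _ _ hv
    obtain ⟨γ, hγ, -⟩ := hsm _ _ hw
    obtain ⟨m, hm⟩ := hm
    -- The coprime factors `k * l * q` and `u * v * w` of the cube are cubes.
    have hm' : (k * l * q) * (u * v * w) = m ^ 3 := by rw [← hm]; ring
    have hco : Nat.Coprime (k * l * q) (u * v * w) := by
      rw [← hα, ← hβ, ← hγ]
      refine Nat.Coprime.mul_left (Nat.Coprime.mul_left ?_ ?_) ?_ <;>
        refine Nat.Coprime.mul_right (Nat.Coprime.mul_right ?_ ?_) ?_ <;>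
        first
        | exact coprime_smoothNumber hk _
        | exact coprime_smoothNumber hl _
        | exact coprime_smoothNumber hq _
    obtain ⟨m₁, hm₁⟩ := exists_eq_pow_of_mul_eq_pow (Nat.isUnit_iff.2 hco) hm'
    obtain ⟨m₂, hm₂⟩ := exists_eq_pow_of_mul_eq_pow (Nat.isUnit_iff.2 hco.symm)
      ((mul_comm _ _).trans hm')
    have hne : ∀ k ∈ squarefreeSifted r n, k ≠ 0 := fun k hk =>
      Nat.pos_iff_ne_zero.1 (mem_squarefreeSifted.1 hk).1.1
    obtain ⟨rfl, rfl⟩ := eq_of_mul_eq_cube (hne _ hk) (hne _ hl) (hne _ hq)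
      (factorization_le_one_of_mem hk) (factorization_le_one_of_mem hl)
      (factorization_le_one_of_mem hq) hm₁
    obtain ⟨rfl, rfl⟩ := (onlyTrivialSolutions_three_iff _).1 (hS (n / k)) u hu v hv w hw ⟨m₂, hm₂⟩
    exact ⟨rfl, rfl⟩

/-! ### Densities of sifted sets -/

theorem tendsto_natDiv_div (i : ℕ) :
    Tendsto (fun n : ℕ => ((n / i : ℕ) : ℝ) / n) atTop (𝓝 (1 / i)) := by
  have h := (tendsto_nat_floor_mul_div_atTop (R := ℝ) (a := 1 / i) (by positivity)).comp
    tendsto_natCast_atTop_atTop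
  refine h.congr fun n => ?_
  simp only [Function.comp_apply]
  rw [one_div_mul_eq_div, Nat.floor_div_eq_div]

theorem tendsto_comp_natDiv {f : ℕ → ℝ} {δ : ℝ} (h0 : f 0 = 0)
    (hf : Tendsto (fun n : ℕ => f n / n) atTop (𝓝 δ)) {i : ℕ} (hi : 0 < i) :
    Tendsto (fun n : ℕ => f (n / i) / n) atTop (𝓝 (δ / i)) := by
  have h1 : Tendsto (fun n : ℕ => n / i) atTop atTop := Nat.tendsto_div_const_atTop hi.ne'
  have h2 := (hf.comp h1).mul (tendsto_natDiv_div i)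
  rw [mul_one_div] at h2
  refine h2.congr fun n => ?_
  simp only [Function.comp_apply]
  by_cases hn : n / i = 0
  · simp [hn, h0]
  · have : ((n / i : ℕ) : ℝ) ≠ 0 := Nat.cast_ne_zero.2 hn
    field_simp

theorem card_sifted_succ {m : ℕ → ℕ} {J : ℕ} (hm : 0 < m J)
    (hco : ∀ j < J, Nat.Coprime (m j) (m J)) (n : ℕ) :
    (sifted m (J + 1) n).card + (sifted m J (n / m J)).card = (sifted m J n).card := by
  classical
  have h1 : sifted m (J + 1) n = (sifted m J n).filter fun k => ¬ m J ∣ k := by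
    ext k
    simp only [mem_sifted, Finset.mem_filter, Nat.lt_succ_iff_lt_or_eq, or_imp, forall_and,
      forall_eq, and_assoc]
  have h2 : (sifted m J (n / m J)).image (fun k => m J * k) =
      (sifted m J n).filter fun k => m J ∣ k := by
    ext k
    simp only [Finset.mem_image, mem_sifted, Finset.mem_filter]
    constructor
    · rintro ⟨l, ⟨⟨hl1, hl2⟩, hl⟩, rfl⟩
      rw [Nat.le_div_iff_mul_le hm, mul_comm] at hl2
      exact ⟨⟨⟨Nat.mul_pos hm hl1, hl2⟩, fun j hj hd => hl j hj ((hco j hj).dvd_of_dvd_mul_left hd)⟩,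
        dvd_mul_right _ _⟩
    · rintro ⟨⟨⟨hl1, hl2⟩, hl⟩, l, rfl⟩
      refine ⟨l, ⟨⟨Nat.pos_of_mul_pos_left hl1, ?_⟩, fun j hj hd => hl j hj (hd.mul_left _)⟩, rfl⟩
      rwa [Nat.le_div_iff_mul_le hm, mul_comm]
  rw [h1, ← Finset.card_image_of_injective (sifted m J (n / m J)) (mul_right_injective₀ hm.ne'), h2,
    add_comm, Finset.card_filter_add_card_filter_not]

@[simp] theorem sifted_zero_right (m : ℕ → ℕ) (J : ℕ) : sifted m J 0 = ∅ := by
  ext k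
  rw [mem_sifted]
  simp
  omega

/-- Sifting by pairwise coprime moduli leaves a set of the expected density. -/
theorem tendsto_card_sifted {m : ℕ → ℕ} (hm : ∀ j, 0 < m j)
    (hco : Pairwise fun i j => Nat.Coprime (m i) (m j)) (J : ℕ) :
    Tendsto (fun n : ℕ => ((sifted m J n).card : ℝ) / n) atTop
      (𝓝 (∏ j ∈ Finset.range J, (1 - 1 / (m j : ℝ)))) := by
  induction J with
  | zero =>
    refine (tendsto_const_nhds (x := (1 : ℝ))).congr' ?_
    filter_upwards [eventually_gt_atTop 0] with n hn
    have : sifted m 0 n = Finset.Icc 1 n := by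
      ext k
      simp [mem_sifted]
    rw [this, Nat.card_Icc, Nat.add_sub_cancel, div_self (Nat.cast_ne_zero.2 hn.ne')]
  | succ J ih =>
    have h := ih.sub (tendsto_comp_natDiv (f := fun n => ((sifted m J n).card : ℝ)) (by simp) ih
      (hm J))
    rw [Finset.prod_range_succ]
    convert h using 2 with n
    · rw [← sub_div, ← card_sifted_succ (hm J) (fun j hj => hco hj.ne) n]
      push_cast
      ring
    · ring

theorem coprime_sieveModulus (r : ℕ) :
    Pairwise fun i j => Nat.Coprime (sieveModulus r i) (sieveModulus r j) := by
  intro i j hij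
  refine Nat.Coprime.coprime_dvd_left (sieveModulus_dvd_sq r i)
    (Nat.Coprime.coprime_dvd_right (sieveModulus_dvd_sq r j) (Nat.Coprime.pow 2 2 ?_))
  exact (Nat.coprime_primes (prime_nthPrime i) (prime_nthPrime j)).2 fun h =>
    hij (nthPrime_injective h)

theorem sieveModulus_pos (r j : ℕ) : 0 < sieveModulus r j :=
  Nat.pos_of_dvd_of_pos (sieveModulus_dvd_sq r j) (pow_pos (prime_nthPrime j).pos 2)

theorem lt_nthPrime (j : ℕ) : j < nthPrime j := by
  have := Nat.add_two_le_nth_prime j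
  change j < Nat.nth Nat.Prime j
  omega

theorem summable_one_div_nthPrime_sq (r : ℕ) :
    Summable fun j : ℕ => 1 / (nthPrime (j + r) : ℝ) ^ 2 := by
  have h2 : Summable fun n : ℕ => 1 / (n : ℝ) ^ 2 :=
    Real.summable_one_div_nat_pow.mpr (by norm_num)
  exact h2.comp_injective (i := fun j : ℕ => nthPrime (j + r))
    fun a b h => Nat.add_right_cancel (nthPrime_injective h)

/-- Few numbers survive the first `J` moduli but not the later ones. -/
theorem card_sifted_le (r J n : ℕ) (hJ : r ≤ J) :
    ((sifted (sieveModulus r) J n).card : ℝ) ≤ (squarefreeSifted r n).card +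
      n * ∑' j : ℕ, 1 / (nthPrime (j + J) : ℝ) ^ 2 := by
  classical
  have hsub : sifted (sieveModulus r) J n ⊆ squarefreeSifted r n ∪
      (Finset.range n).biUnion fun j => (Finset.Ioc 0 n).filter fun k => nthPrime (j + J) ^ 2 ∣ k := by
    intro k hk
    by_cases hk' : k ∈ squarefreeSifted r n
    · exact Finset.mem_union_left _ hk'
    · refine Finset.mem_union_right _ ?_
      rw [mem_sifted] at hk
      rw [mem_squarefreeSifted, not_and_or, or_iff_right (not_not.2 hk.1)] at hk'
      push Not at hk'
      obtain ⟨j, hj⟩ := hk'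
      have hJj : J ≤ j := by
        by_contra h
        exact hk.2 j (by omega) hj
      rw [sieveModulus, if_neg (by omega)] at hj
      have hjk : j < k := calc
        j < nthPrime j := lt_nthPrime j
        _ ≤ nthPrime j ^ 2 := Nat.le_self_pow two_ne_zero _
        _ ≤ k := Nat.le_of_dvd hk.1.1 hj
      refine Finset.mem_biUnion.2 ⟨j - J, Finset.mem_range.2 (by omega), ?_⟩
      rw [Nat.sub_add_cancel hJj]
      exact Finset.mem_filter.2 ⟨Finset.mem_Ioc.2 hk.1, hj⟩
  have h1 := (Finset.card_le_card hsub).trans ((Finset.card_union_le _ _).trans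
    (Nat.add_le_add_left Finset.card_biUnion_le _))
  have h2 : ((∑ j ∈ Finset.range n, ((Finset.Ioc 0 n).filter fun k =>
      nthPrime (j + J) ^ 2 ∣ k).card : ℕ) : ℝ) ≤ n * ∑' j : ℕ, 1 / (nthPrime (j + J) : ℝ) ^ 2 := by
    push_cast
    calc ∑ j ∈ Finset.range n, (((Finset.Ioc 0 n).filter fun k =>
          nthPrime (j + J) ^ 2 ∣ k).card : ℝ)
        ≤ ∑ j ∈ Finset.range n, n * (1 / (nthPrime (j + J) : ℝ) ^ 2) := by
          refine Finset.sum_le_sum fun j _ => ?_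
          rw [Nat.Ioc_filter_dvd_card_eq_div, mul_one_div]
          exact_mod_cast Nat.cast_div_le (α := ℝ) (m := n) (n := nthPrime (j + J) ^ 2)
      _ = n * ∑ j ∈ Finset.range n, 1 / (nthPrime (j + J) : ℝ) ^ 2 := by rw [Finset.mul_sum]
      _ ≤ n * ∑' j : ℕ, 1 / (nthPrime (j + J) : ℝ) ^ 2 := by
          gcongr
          exact (summable_one_div_nthPrime_sq J).sum_le_tsum _ fun j _ => by positivity
  refine (Nat.cast_le (α := ℝ).2 h1).trans ?_
  rw [Nat.cast_add]
  exact add_le_add le_rfl h2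

/-! ### Summation by parts -/

theorem sum_diff_div (s : ℕ → ℝ) (h0 : s 0 = 0) (N : ℕ) (hN : 1 ≤ N) :
    ∑ i ∈ Finset.Icc 1 N, (s i - s (i - 1)) / i =
      s N / N + ∑ i ∈ Finset.Icc 1 (N - 1), s i / ((i : ℝ) * ((i : ℝ) + 1)) := by
  induction N, hN using Nat.le_induction with
  | base => simp [h0]
  | succ N hN ih =>
    rw [Finset.sum_Icc_succ_top (by omega), ih]
    obtain ⟨M, rfl⟩ : ∃ M, N = M + 1 := ⟨N - 1, by omega⟩
    simp only [Nat.add_sub_cancel]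
    rw [Finset.sum_Icc_succ_top (by omega)]
    push_cast
    have h1 : (M : ℝ) + 1 ≠ 0 := by positivity
    have h2 : (M : ℝ) + 1 + 1 ≠ 0 := by positivity
    field_simp
    ring

theorem primeSqProd_pos (r : ℕ) : 1 ≤ primeSqProd r :=
  Finset.prod_pos fun j _ => pow_pos (prime_nthPrime j).pos 2

theorem smoothNumber_le_primeSqProd (r : ℕ) (α : Fin r → ZMod 3) :
    smoothNumber r α ≤ primeSqProd r := by
  rw [primeSqProd, Finset.prod_range, smoothNumber]
  exact Finset.prod_le_prod' fun j _ =>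
    Nat.pow_le_pow_right (prime_nthPrime j).pos (Nat.le_of_lt_succ (ZMod.val_lt (α j)))

theorem smoothMax_zero_right (r : ℕ) : smoothMax r 0 = 0 := by
  rw [smoothMax_eq_capMax]
  obtain ⟨S, -, hi, hcard⟩ := exists_card_eq_capMax r 0
  rw [← hcard, Finset.card_eq_zero, Finset.eq_empty_iff_forall_notMem]
  intro α hα
  exact (smoothNumber_pos r α).ne' (Nat.le_zero.1 (hi α hα))

theorem smoothMax_of_le {r m : ℕ} (h : primeSqProd r ≤ m) :
    smoothMax r m = smoothMax r (primeSqProd r) := by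
  refine le_antisymm ?_ (smoothMax_mono r h)
  rw [smoothMax_eq_capMax, smoothMax_eq_capMax]
  obtain ⟨S, hS, -, hcard⟩ := exists_card_eq_capMax r m
  rw [← hcard]
  exact card_le_capMax hS fun α _ => smoothNumber_le_primeSqProd r α

/-- The increment of the step function `s_r` at `i`. -/
noncomputable def smoothJump (r i : ℕ) : ℝ := (smoothMax r i : ℝ) - smoothMax r (i - 1)

theorem smoothJump_nonneg (r i : ℕ) : 0 ≤ smoothJump r i :=
  sub_nonneg.2 (Nat.cast_le.2 (smoothMax_mono r (Nat.sub_le i 1)))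

theorem gammaBound_eq (r : ℕ) : gammaBound r =
    (∑ i ∈ Finset.Icc 1 (primeSqProd r), smoothJump r i / i) *
      ∏ j ∈ Finset.range r, (1 - 1 / (nthPrime j : ℝ)) := by
  rw [gammaBound]
  congr 1
  exact (sum_diff_div (fun i => (smoothMax r i : ℝ)) (by simp [smoothMax_zero_right]) _
    (primeSqProd_pos r)).symm

theorem smoothMax_eq_sum_jumps (r m : ℕ) : (smoothMax r m : ℝ) =
    ∑ i ∈ Finset.Icc 1 (primeSqProd r), if i ≤ m then smoothJump r i else 0 := by
  have htel : ∀ M : ℕ, ∑ i ∈ Finset.Icc 1 M, smoothJump r i = smoothMax r M := by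
    intro M
    induction M with
    | zero => simp [smoothMax_zero_right]
    | succ M ih =>
      rw [Finset.sum_Icc_succ_top (by omega), ih, smoothJump, Nat.add_sub_cancel]
      ring
  rw [← Finset.sum_filter]
  have hset : (Finset.Icc 1 (primeSqProd r)).filter (· ≤ m) =
      Finset.Icc 1 (min (primeSqProd r) m) := by
    ext i
    simp [and_assoc]
  rw [hset, htel]
  rcases le_total (primeSqProd r) m with h | h
  · rw [min_eq_left h, smoothMax_of_le h]
  · rw [min_eq_right h]

/-- Counting the terms by the jumps of `s_r`. -/
theorem sum_smoothMax_div (r n : ℕ) (P : ℕ → Prop) [DecidablePred P] :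
    ((∑ k ∈ (Finset.Icc 1 n).filter P, smoothMax r (n / k) : ℕ) : ℝ) =
      ∑ i ∈ Finset.Icc 1 (primeSqProd r),
        smoothJump r i * ((Finset.Icc 1 (n / i)).filter P).card := by
  push_cast
  simp only [smoothMax_eq_sum_jumps]
  rw [Finset.sum_comm]
  refine Finset.sum_congr rfl fun i hi => ?_
  have hi1 : 0 < i := (Finset.mem_Icc.1 hi).1
  rw [← Finset.sum_filter, Finset.sum_const, nsmul_eq_mul, mul_comm]
  congr 2
  congr 1
  ext k
  simp only [Finset.mem_filter, Finset.mem_Icc]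
  constructor
  · rintro ⟨⟨⟨hk1, hkn⟩, hP⟩, hik⟩
    rw [Nat.le_div_iff_mul_le hk1, mul_comm] at hik
    exact ⟨⟨hk1, (Nat.le_div_iff_mul_le hi1).2 hik⟩, hP⟩
  · rintro ⟨⟨hk1, hkn⟩, hP⟩
    rw [Nat.le_div_iff_mul_le hi1] at hkn
    exact ⟨⟨⟨hk1, (Nat.le_mul_of_pos_right k hi1).trans hkn⟩, hP⟩,
      (Nat.le_div_iff_mul_le hk1).2 (by rwa [mul_comm])⟩

/-! ### Asymptotic bounds -/

/-- The upper bound for `f(n) / n` obtained from the first `r` primes. -/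
noncomputable def upperRatio (r n : ℕ) : ℝ :=
  ∑ i ∈ Finset.Icc 1 (primeSqProd r), smoothJump r i * (((sifted nthPrime r (n / i)).card : ℝ) / n)

theorem extremalF_div_le (r n : ℕ) : (extremalF 3 3 n : ℝ) / n ≤ upperRatio r n := by
  have h : (extremalF 3 3 n : ℝ) ≤ _ := Nat.cast_le.2 (extremalF_le_sum r n)
  rw [sifted, sum_smoothMax_div] at h
  simp only [upperRatio, ← mul_div_assoc, ← Finset.sum_div]
  exact div_le_div_of_nonneg_right h (Nat.cast_nonneg n)

theorem tendsto_upperRatio (r : ℕ) : Tendsto (upperRatio r) atTop (𝓝 (gammaBound r)) := by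
  rw [gammaBound_eq, Finset.sum_mul]
  refine tendsto_finsetSum _ fun i hi => ?_
  rw [div_mul_eq_mul_div, mul_div_assoc]
  refine Tendsto.const_mul _ (tendsto_comp_natDiv (f := fun n => ((sifted nthPrime r n).card : ℝ))
    (by simp) (tendsto_card_sifted (fun j => (prime_nthPrime j).pos) ?_ r)
    (Finset.mem_Icc.1 hi).1)
  exact fun i j hij => (Nat.coprime_primes (prime_nthPrime i) (prime_nthPrime j)).2 fun h =>
    hij (nthPrime_injective h)

/-- The lower bound for `f(n) / n` obtained from the first `r` primes when the squarefree numbers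
are replaced by those sifted by the first `r + M` moduli. -/
noncomputable def lowerRatio (r M n : ℕ) : ℝ :=
  ∑ i ∈ Finset.Icc 1 (primeSqProd r), smoothJump r i *
    (((sifted (sieveModulus r) (r + M) (n / i)).card : ℝ) / n -
      ((n / i : ℕ) : ℝ) / n * ∑' j : ℕ, 1 / (nthPrime (j + (r + M)) : ℝ) ^ 2)

theorem lowerRatio_le (r M n : ℕ) : lowerRatio r M n ≤ (extremalF 3 3 n : ℝ) / n := by
  have h : _ ≤ (extremalF 3 3 n : ℝ) := Nat.cast_le.2 (sum_le_extremalF r n)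
  rw [squarefreeSifted, sum_smoothMax_div] at h
  refine le_trans ?_ (div_le_div_of_nonneg_right h (Nat.cast_nonneg n))
  rw [Finset.sum_div, lowerRatio]
  refine Finset.sum_le_sum fun i _ => ?_
  rw [mul_div_assoc]
  refine mul_le_mul_of_nonneg_left ?_ (smoothJump_nonneg r i)
  rw [div_mul_eq_mul_div, ← sub_div]
  refine div_le_div_of_nonneg_right ?_ (Nat.cast_nonneg n)
  rw [sub_le_iff_le_add]
  exact card_sifted_le r (r + M) (n / i) (Nat.le_add_right r M)

/-- The limit of `lowerRatio r M n` as `n` tends to infinity. -/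
noncomputable def lowerLimit (r M : ℕ) : ℝ :=
  (∑ i ∈ Finset.Icc 1 (primeSqProd r), smoothJump r i / i) *
    (∏ j ∈ Finset.range (r + M), (1 - 1 / (sieveModulus r j : ℝ)) -
      ∑' j : ℕ, 1 / (nthPrime (j + (r + M)) : ℝ) ^ 2)

theorem tendsto_lowerRatio (r M : ℕ) :
    Tendsto (lowerRatio r M) atTop (𝓝 (lowerLimit r M)) := by
  rw [lowerLimit, Finset.sum_mul]
  refine tendsto_finsetSum _ fun i hi => ?_
  rw [div_mul_eq_mul_div, mul_div_assoc, sub_div]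
  refine Tendsto.const_mul _ (Tendsto.sub ?_ ?_)
  · exact tendsto_comp_natDiv (f := fun n => ((sifted (sieveModulus r) (r + M) n).card : ℝ))
      (by simp) (tendsto_card_sifted (sieveModulus_pos r) (coprime_sieveModulus r) (r + M))
      (Finset.mem_Icc.1 hi).1
  · rw [div_eq_mul_one_div, mul_comm]
    exact (tendsto_natDiv_div i).mul_const _

theorem tendsto_lowerLimit (r : ℕ) : Tendsto (lowerLimit r) atTop (𝓝 (betaBound r)) := by
  have hsplit : ∀ M, ∏ j ∈ Finset.range (r + M), (1 - 1 / (sieveModulus r j : ℝ)) =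
      (∏ j ∈ Finset.range r, (1 - 1 / (nthPrime j : ℝ))) *
        ∏ j ∈ Finset.range M, (1 - 1 / (nthPrime (r + j) : ℝ) ^ 2) := by
    intro M
    rw [Finset.prod_range_add]
    congr 1
    · refine Finset.prod_congr rfl fun j hj => ?_
      rw [sieveModulus, if_pos (Finset.mem_range.1 hj)]
    · refine Finset.prod_congr rfl fun j _ => ?_
      rw [sieveModulus, if_neg (by omega), Nat.cast_pow]
  have h1 := (multipliable_primeTail r).hasProd.tendsto_prod_nat
  have h2 : Tendsto (fun M => ∑' j : ℕ, 1 / (nthPrime (j + (r + M)) : ℝ) ^ 2) atTop (𝓝 0) := by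
    have := tendsto_sum_nat_add fun j : ℕ => 1 / (nthPrime (j + r) : ℝ) ^ 2
    refine this.congr fun M => tsum_congr fun j => ?_
    rw [add_assoc, add_comm M r]
  have h3 := ((h1.const_mul (∏ j ∈ Finset.range r, (1 - 1 / (nthPrime j : ℝ)))).sub h2).const_mul
    (∑ i ∈ Finset.Icc 1 (primeSqProd r), smoothJump r i / i)
  rw [sub_zero, ← mul_assoc, ← gammaBound_eq] at h3
  refine h3.congr fun M => ?_
  rw [lowerLimit, hsplit]

theorem betaBound_le_gammaBound (r r' : ℕ) : betaBound r ≤ gammaBound r' := by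
  refine le_of_tendsto' (tendsto_lowerLimit r) fun M => ?_
  exact le_of_tendsto_of_tendsto' (tendsto_lowerRatio r M) (tendsto_upperRatio r') fun n =>
    (lowerRatio_le r M n).trans (extremalF_div_le r' n)

/-! ### The Euler product of the squares of the primes -/

/-- The product of `1 - 1 / p²` over all primes but the first `r`. -/
noncomputable def primeTail (r : ℕ) : ℝ := ∏' j : ℕ, (1 - 1 / (nthPrime (r + j) : ℝ) ^ 2)

theorem one_sub_inv_sq_pos (j : ℕ) : 0 < 1 - 1 / (nthPrime j : ℝ) ^ 2 := by
  have h2 : (2 : ℝ) ≤ nthPrime j := by exact_mod_cast (prime_nthPrime j).two_le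
  rw [sub_pos, div_lt_one (by positivity)]
  nlinarith

theorem primeTail_zero : primeTail 0 = 6 / Real.pi ^ 2 := by
  have h1 := (multipliable_primeTail 0).hasProd.tendsto_prod_nat
  simp only [zero_add] at h1
  let f : ℕ →*₀ ℝ :=
    { toFun := fun n => 1 / (n : ℝ) ^ 2
      map_zero' := by simp
      map_one' := by simp
      map_mul' := fun a b => by push_cast; rw [mul_pow, one_div_mul_one_div] }
  have hf : ∀ n, f n = 1 / (n : ℝ) ^ 2 := fun n => rfl
  have hsum : Summable fun n => ‖f n‖ := by
    simp only [hf, Real.norm_eq_abs]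
    exact (Real.summable_one_div_nat_pow.mpr (by norm_num)).abs
  have h2 := EulerProduct.eulerProduct_completely_multiplicative_hasProd hsum
  let e : ℕ ≃ Nat.Primes := Equiv.ofBijective (fun j => ⟨nthPrime j, prime_nthPrime j⟩)
    ⟨fun a b h => nthPrime_injective (congrArg Subtype.val h), fun p => by
      obtain ⟨j, hj⟩ := exists_nthPrime_eq p.2
      exact ⟨j, Subtype.ext hj⟩⟩
  have h3 := (e.hasProd_iff.2 h2).tendsto_prod_nat
  have h4 : ∑' n, f n = Real.pi ^ 2 / 6 := hasSum_zeta_two.tsum_eq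
  rw [h4] at h3
  have h5 := h1.mul h3
  have h6 : ∀ n, (∏ j ∈ Finset.range n, (1 - 1 / (nthPrime j : ℝ) ^ 2)) *
      ∏ j ∈ Finset.range n, ((fun p : Nat.Primes => (1 - f p)⁻¹) ∘ e) j = 1 := by
    intro n
    rw [← Finset.prod_mul_distrib]
    refine Finset.prod_eq_one fun j _ => ?_
    exact mul_inv_cancel₀ (one_sub_inv_sq_pos j).ne'
  simp only [h6] at h5
  have h7 := tendsto_nhds_unique h5 tendsto_const_nhds
  have hpi : Real.pi ≠ 0 := Real.pi_ne_zero
  have h8 : primeTail 0 * (Real.pi ^ 2 / 6) = 1 := by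
    simpa [primeTail] using h7
  field_simp at h8 ⊢
  linarith

theorem prod_mul_primeTail (r : ℕ) :
    (∏ j ∈ Finset.range r, (1 - 1 / (nthPrime j : ℝ) ^ 2)) * primeTail r = primeTail 0 := by
  have h0 := (multipliable_primeTail 0).hasProd.tendsto_prod_nat
  have hr := (multipliable_primeTail r).hasProd.tendsto_prod_nat
  simp only [zero_add] at h0
  have h1 := hr.const_mul (∏ j ∈ Finset.range r, (1 - 1 / (nthPrime j : ℝ) ^ 2))
  have h2 := h0.comp (tendsto_add_atTop_nat r)
  have h3 := tendsto_nhds_unique h1 (h2.congr fun M => by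
    simp only [Function.comp_apply]
    rw [add_comm, Finset.prod_range_add])
  simpa [primeTail] using h3

theorem primeTail_zero_pos : 0 < primeTail 0 := by
  rw [primeTail_zero]
  have := Real.pi_pos
  positivity

theorem prod_one_sub_inv_sq_pos (r : ℕ) :
    0 < ∏ j ∈ Finset.range r, (1 - 1 / (nthPrime j : ℝ) ^ 2) :=
  Finset.prod_pos fun j _ => one_sub_inv_sq_pos j

theorem primeTail_pos (r : ℕ) : 0 < primeTail r := by
  have h := primeTail_zero_pos
  rw [← prod_mul_primeTail r] at h
  exact pos_of_mul_pos_right h (prod_one_sub_inv_sq_pos r).le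

theorem tendsto_primeTail : Tendsto primeTail atTop (𝓝 1) := by
  have h0 := (multipliable_primeTail 0).hasProd.tendsto_prod_nat
  simp only [zero_add] at h0
  have h1 : Tendsto (fun r => primeTail 0 /
      ∏ j ∈ Finset.range r, (1 - 1 / (nthPrime j : ℝ) ^ 2)) atTop (𝓝 (primeTail 0 / primeTail 0)) := by
    refine tendsto_const_nhds.div ?_ primeTail_zero_pos.ne'
    simpa [primeTail] using h0
  rw [div_self primeTail_zero_pos.ne'] at h1
  refine h1.congr fun r => ?_
  rw [div_eq_iff (prod_one_sub_inv_sq_pos r).ne', mul_comm, prod_mul_primeTail]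

theorem betaBound_eq (r : ℕ) : betaBound r = gammaBound r * primeTail r := rfl

/-! ### The limit -/

theorem exists_limit : ∃ c : ℝ,
    Tendsto (fun n : ℕ => (extremalF 3 3 n : ℝ) / (n : ℝ)) atTop (𝓝 c) ∧
      IsGLB (gammaBound '' Set.Ici 1) c ∧ IsLUB (betaBound '' Set.Ici 1) c := by
  have hne : (gammaBound '' Set.Ici 1).Nonempty := Set.nonempty_Ici.image _
  have hbdd : BddBelow (gammaBound '' Set.Ici 1) := by
    refine ⟨betaBound 1, ?_⟩
    rintro _ ⟨r, -, rfl⟩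
    exact betaBound_le_gammaBound 1 r
  set c := sInf (gammaBound '' Set.Ici 1) with hc
  have hglb : IsGLB (gammaBound '' Set.Ici 1) c := isGLB_csInf hne hbdd
  have hbc : ∀ r, betaBound r ≤ c := by
    intro r
    refine le_csInf hne ?_
    rintro _ ⟨r', -, rfl⟩
    exact betaBound_le_gammaBound r r'
  have hcg : ∀ r, 1 ≤ r → c ≤ gammaBound r := fun r hr => hglb.1 ⟨r, hr, rfl⟩
  have hlow : ∀ r, 1 ≤ r → c * primeTail r ≤ betaBound r := fun r hr => by
    rw [betaBound_eq]
    exact mul_le_mul_of_nonneg_right (hcg r hr) (primeTail_pos r).le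
  have hbeta : Tendsto betaBound atTop (𝓝 c) := by
    have h1 := tendsto_primeTail.const_mul c
    rw [mul_one] at h1
    refine tendsto_of_tendsto_of_tendsto_of_le_of_le' h1 tendsto_const_nhds ?_
      (Eventually.of_forall hbc)
    filter_upwards [eventually_ge_atTop 1] with r hr using hlow r hr
  have hgamma : Tendsto gammaBound atTop (𝓝 c) := by
    have h1 := hbeta.div tendsto_primeTail one_ne_zero
    rw [div_one] at h1
    refine h1.congr fun r => ?_
    rw [Pi.div_apply, betaBound_eq, mul_div_cancel_right₀ _ (primeTail_pos r).ne']
  refine ⟨c, tendsto_order.2 ⟨fun a ha => ?_, fun b hb => ?_⟩, hglb, ?_, ?_⟩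
  · obtain ⟨r, hr⟩ := (hbeta.eventually (lt_mem_nhds ha)).exists
    obtain ⟨M, hM⟩ := ((tendsto_lowerLimit r).eventually (lt_mem_nhds hr)).exists
    filter_upwards [(tendsto_lowerRatio r M).eventually (lt_mem_nhds hM)] with n hn
    exact hn.trans_le (lowerRatio_le r M n)
  · obtain ⟨r, hr⟩ := (hgamma.eventually (gt_mem_nhds hb)).exists
    filter_upwards [(tendsto_upperRatio r).eventually (gt_mem_nhds hr)] with n hn
    exact (extremalF_div_le r n).trans_lt hn
  · rintro _ ⟨r, -, rfl⟩
    exact hbc r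
  · intro b hb
    refine le_of_tendsto hbeta ?_
    filter_upwards [eventually_ge_atTop 1] with r hr using hb ⟨r, hr, rfl⟩

/-! ### Bounds for `γ_r` by step functions -/

theorem sum_one_div_eq (T : Finset ℕ) (N : ℕ) (hN : 1 ≤ N) (hT : T ⊆ Finset.Icc 1 N) :
    ((T.filter (· ≤ N)).card : ℝ) / N + ∑ i ∈ Finset.Icc 1 (N - 1),
      ((T.filter (· ≤ i)).card : ℝ) / ((i : ℝ) * ((i : ℝ) + 1)) = ∑ t ∈ T, 1 / (t : ℝ) := by
  have h0 : T.filter (· ≤ 0) = ∅ := by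
    rw [Finset.filter_eq_empty_iff]
    intro t ht
    have := (Finset.mem_Icc.1 (hT ht)).1
    omega
  rw [← sum_diff_div (fun i => ((T.filter (· ≤ i)).card : ℝ)) (by simp only [h0, Finset.card_empty, Nat.cast_zero]) N hN,
    ← Finset.sum_subset hT (fun i _ hi => ?_)]
  · refine Finset.sum_congr rfl fun t ht => ?_
    have ht1 := (Finset.mem_Icc.1 (hT ht)).1
    have : T.filter (· ≤ t) = insert t (T.filter (· ≤ t - 1)) := by
      ext i
      simp only [Finset.mem_filter, Finset.mem_insert]
      constructor
      · rintro ⟨hi, hit⟩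
        by_cases h : i = t
        · exact Or.inl h
        · exact Or.inr ⟨hi, by omega⟩
      · rintro (rfl | ⟨hi, hit⟩)
        · exact ⟨ht, le_rfl⟩
        · exact ⟨hi, by omega⟩
    rw [this, Finset.card_insert_of_notMem (by simp; omega)]
    push_cast
    ring
  · have : T.filter (· ≤ i) = T.filter (· ≤ i - 1) := by
      refine Finset.filter_congr fun t ht => ?_
      have : t ≠ i := fun h => hi (h ▸ ht)
      have ht1 := (Finset.mem_Icc.1 (hT ht)).1
      omega
    rw [this, sub_self, zero_div]

theorem prod_one_sub_inv_nonneg (r : ℕ) :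
    0 ≤ ∏ j ∈ Finset.range r, (1 - 1 / (nthPrime j : ℝ)) := by
  refine Finset.prod_nonneg fun j _ => ?_
  have h1 : (1 : ℝ) ≤ nthPrime j := by exact_mod_cast (prime_nthPrime j).one_le
  rw [sub_nonneg, div_le_one (by positivity)]
  exact h1

/-- If `s_r` has not increased more than the counting function of `T` before each element of `T`,
then `γ_r` is at most the value for this counting function. -/
theorem gammaBound_le (r : ℕ) (T : Finset ℕ) (hT : T ⊆ Finset.Icc 1 (primeSqProd r))
    (hs : ∀ t ∈ T, smoothMax r (t - 1) ≤ (T.filter (· ≤ t - 1)).card)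
    (htop : ∀ i, smoothMax r i ≤ T.card) :
    gammaBound r ≤ (∑ t ∈ T, 1 / (t : ℝ)) * ∏ j ∈ Finset.range r, (1 - 1 / (nthPrime j : ℝ)) := by
  have hle : ∀ i, smoothMax r i ≤ (T.filter (· ≤ i)).card := by
    intro i
    by_cases hne : (T.filter (i < ·)).Nonempty
    · obtain ⟨ht, hit⟩ := Finset.mem_filter.1 (Finset.min'_mem _ hne)
      set t := (T.filter (i < ·)).min' hne with htdef
      have heq : T.filter (· ≤ t - 1) = T.filter (· ≤ i) := by
        refine Finset.filter_congr fun u hu => ⟨fun h => ?_, fun h => by omega⟩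
        by_contra hui
        have := Finset.min'_le (T.filter (i < ·)) u (Finset.mem_filter.2 ⟨hu, by omega⟩)
        omega
      exact (smoothMax_mono r (by omega)).trans (heq ▸ hs t ht)
    · rw [Finset.not_nonempty_iff_eq_empty, Finset.filter_eq_empty_iff] at hne
      rw [Finset.filter_true_of_mem fun u hu => not_lt.1 (hne hu)]
      exact htop i
  rw [gammaBound, ← sum_one_div_eq T _ (primeSqProd_pos r) hT]
  refine mul_le_mul_of_nonneg_right ?_ (prod_one_sub_inv_nonneg r)
  gcongr
  · exact hle _
  · exact hle _

/-- If `s_r` is at least the counting function of `T` at the elements of `T`, then `γ_r` is at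
least the value for this counting function. -/
theorem le_gammaBound (r : ℕ) (T : Finset ℕ) (hT : T ⊆ Finset.Icc 1 (primeSqProd r))
    (hs : ∀ t ∈ T, (T.filter (· ≤ t)).card ≤ smoothMax r t) :
    (∑ t ∈ T, 1 / (t : ℝ)) * ∏ j ∈ Finset.range r, (1 - 1 / (nthPrime j : ℝ)) ≤ gammaBound r := by
  have hle : ∀ i, (T.filter (· ≤ i)).card ≤ smoothMax r i := by
    intro i
    by_cases hne : (T.filter (· ≤ i)).Nonempty
    · obtain ⟨ht, hit⟩ := Finset.mem_filter.1 (Finset.max'_mem _ hne)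
      set t := (T.filter (· ≤ i)).max' hne with htdef
      have heq : T.filter (· ≤ t) = T.filter (· ≤ i) := by
        refine Finset.filter_congr fun u hu => ⟨fun h => by omega, fun h => ?_⟩
        exact Finset.le_max' _ u (Finset.mem_filter.2 ⟨hu, h⟩)
      exact (heq ▸ hs t ht).trans (smoothMax_mono r hit)
    · rw [Finset.not_nonempty_iff_eq_empty.1 hne]
      simp
  rw [gammaBound, ← sum_one_div_eq T _ (primeSqProd_pos r) hT]
  refine mul_le_mul_of_nonneg_right ?_ (prod_one_sub_inv_nonneg r)
  gcongr
  · exact hle _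
  · exact hle _

/-! ### The step function `s_4` -/

theorem smoothMax_four_le {l m : ℕ} (items : List (ℕ × ℕ)) (hc : checkDolls items = true)
    (hnd : (items.map Prod.fst).Nodup)
    (hcover : ∀ a b c d : Fin 3, 2 ^ (a : ℕ) * 3 ^ (b : ℕ) * 5 ^ (c : ℕ) * 7 ^ (d : ℕ) ≤ l →
      (a : ℕ) + 3 * b + 9 * c + 27 * d ∈ items.map Prod.fst)
    (hm : headBound items ≤ m) : smoothMax 4 l ≤ m := by
  rw [smoothMax_eq_capMax]
  obtain ⟨S, hS, hl, hcard⟩ := exists_card_eq_capMax 4 l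
  rw [← hcard]
  exact (card_le_headBound hS l hl items hnd hc hcover).trans hm

/-- The number whose exponent vector at the primes `2, 3, 5, 7` has the code `c`. -/
def codeNumber (c : ℕ) : ℕ := 2 ^ (c % 3) * 3 ^ (c / 3 % 3) * 5 ^ (c / 9 % 3) * 7 ^ (c / 27 % 3)

theorem codeNumber_pointCode (v : Fin 4 → ZMod 3) :
    codeNumber (pointCode v) = smoothNumber 4 v := by
  have h0 := ZMod.val_lt (v 0)
  have h1 := ZMod.val_lt (v 1)
  have h2 := ZMod.val_lt (v 2)
  have h3 := ZMod.val_lt (v 3)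
  rw [smoothNumber_four, codeNumber]
  congr 4 <;> simp only [pointCode] <;> omega

theorem exists_pointCode_eq {c : ℕ} (hc : c < 81) : ∃ v, pointCode v = c := by
  refine ⟨![(c : ZMod 3), ((c / 3 : ℕ) : ZMod 3), ((c / 9 : ℕ) : ZMod 3), ((c / 27 : ℕ) : ZMod 3)], ?_⟩
  simp [pointCode, ZMod.val_natCast]
  omega

theorem card_le_smoothMax_four (C : Finset ℕ) (hC : IsCodeCap C) (l : ℕ)
    (hl : ∀ c ∈ C, codeNumber c ≤ l) : C.card ≤ smoothMax 4 l := by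
  set S := Finset.univ.filter fun v : Fin 4 → ZMod 3 => pointCode v ∈ C with hS
  have himg : S.image pointCode = C := by
    ext c
    simp only [hS, Finset.mem_image, Finset.mem_filter, Finset.mem_univ, true_and]
    constructor
    · rintro ⟨v, hv, rfl⟩
      exact hv
    · intro hc
      obtain ⟨v, rfl⟩ := exists_pointCode_eq (hC.1 c hc)
      exact ⟨v, hc, rfl⟩
  have hSC : ∀ {v}, v ∈ S → pointCode v ∈ C := fun hv => (Finset.mem_filter.1 hv).2
  rw [smoothMax_eq_capMax, ← himg, Finset.card_image_of_injective _ pointCode_injective]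
  refine card_le_capMax ?_ fun v hv => codeNumber_pointCode v ▸ hl _ (hSC hv)
  rw [threeAPFree_iff_add_eq_zero]
  have key : ∀ a ∈ S, ∀ b ∈ S, ∀ c ∈ S, a + b + c = 0 → a = b := by
    intro a ha b hb c hc habc
    by_contra hab
    refine hC.2 _ (hSC ha) _ (hSC hb) (fun h => hab (pointCode_injective h)) ?_
    rw [codeThird_pointCode]
    have : -a - b = c := by
      rw [← sub_eq_zero, ← neg_eq_zero, ← habc]
      abel
    rw [this]
    exact hSC hc
  intro a ha b hb c hc habc
  exact ⟨key a ha b hb c hc habc, key b hb c hc a ha (by rw [← habc]; abel)⟩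

/-- Caps, given by the codes of their points, that attain `s_4(i)` for suitable `i`. -/
def witnessCaps : List (List ℕ) :=
  [[0, 1, 3, 5, 9, 10, 13, 15, 22, 27, 30, 31, 34, 37, 38, 39, 45, 55],
   [2, 4, 5, 7, 9, 11, 12, 13, 18, 28, 29, 30, 31, 36],
   [1, 2, 3, 4, 9, 27],
   [0, 4, 5, 6, 9, 10, 12, 27, 28],
   [2, 4, 5, 7, 9, 11, 12, 18, 27, 28, 30],
   [2, 4, 5, 7, 10, 11, 12, 14, 19, 27, 29, 30, 31, 36, 37, 54],
   [1, 3, 4, 6, 9, 10, 27],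
   [3, 4, 7, 8, 9, 13, 15, 16, 21, 27, 29, 32, 33, 36, 37, 39, 55],
   [0, 2, 4, 5, 9, 11, 12, 17, 21, 27, 30, 31, 34, 37, 38, 39, 40, 45, 56],
   [1, 2, 3, 6, 13, 14, 16, 17, 18, 31, 32, 34, 35, 37, 38, 39, 42, 45, 54, 63]]

theorem witnessCaps_isCap : ∀ W ∈ witnessCaps, (∀ a ∈ W, a < 81) ∧
    ∀ a ∈ W, ∀ b ∈ W, a ≠ b → codeThird a b ∉ W := by
  decide +kernel

/-- The numbers at which `s_4` increases. -/
def jumpSet : Finset ℕ :=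
  {1, 2, 3, 5, 6, 7, 10, 14, 15, 21, 25, 30, 35, 42, 60, 70, 105, 175, 210, 315}

theorem exists_witnessCap : ∀ t ∈ jumpSet, ∃ W ∈ witnessCaps,
    (jumpSet.filter (· ≤ t)).card ≤ (W.toFinset.filter fun c => codeNumber c ≤ t).card := by
  decide +kernel

theorem card_filter_jumpSet_le (t : ℕ) (ht : t ∈ jumpSet) :
    (jumpSet.filter (· ≤ t)).card ≤ smoothMax 4 t := by
  obtain ⟨W, hW, hle⟩ := exists_witnessCap t ht
  refine hle.trans (card_le_smoothMax_four _ ?_ t fun c hc => (Finset.mem_filter.1 hc).2)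
  obtain ⟨h1, h2⟩ := witnessCaps_isCap W hW
  have hcap : IsCodeCap W.toFinset := ⟨by simpa using h1, by simpa using h2⟩
  exact hcap.mono (Finset.filter_subset _ _)

/-- The numbers at which the upper bounds for `s_4` increase. The last one is not sharp: the
twentieth element is admitted at `294`, although `s_4` increases only at `315`. -/
def upperJumpSet : Finset ℕ :=
  {1, 2, 3, 5, 6, 7, 10, 14, 15, 21, 25, 30, 35, 42, 60, 70, 105, 175, 210, 294}

theorem smoothMax_le_card_filter (t : ℕ) (ht : t ∈ upperJumpSet) :
    smoothMax 4 (t - 1) ≤ (upperJumpSet.filter (· ≤ t - 1)).card := by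
  simp only [upperJumpSet, Finset.mem_insert, Finset.mem_singleton] at ht
  rcases ht with rfl | rfl | rfl | rfl | rfl | rfl | rfl | rfl | rfl | rfl | rfl | rfl | rfl |
    rfl | rfl | rfl | rfl | rfl | rfl | rfl
  · simp [smoothMax_zero_right]
  · exact smoothMax_four_le items1 checkDolls_items1 (by decide +kernel) (by decide +kernel)
      (by decide +kernel)
  · exact smoothMax_four_le items2 checkDolls_items2 (by decide +kernel) (by decide +kernel)
      (by decide +kernel)
  · exact smoothMax_four_le items4 checkDolls_items4 (by decide +kernel) (by decide +kernel)
      (by decide +kernel)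
  · exact smoothMax_four_le items5 checkDolls_items5 (by decide +kernel) (by decide +kernel)
      (by decide +kernel)
  · exact smoothMax_four_le items6 checkDolls_items6 (by decide +kernel) (by decide +kernel)
      (by decide +kernel)
  · exact smoothMax_four_le items9 checkDolls_items9 (by decide +kernel) (by decide +kernel)
      (by decide +kernel)
  · exact smoothMax_four_le items13 checkDolls_items13 (by decide +kernel) (by decide +kernel)
      (by decide +kernel)
  · exact smoothMax_four_le items14 checkDolls_items14 (by decide +kernel) (by decide +kernel)
      (by decide +kernel)
  · exact smoothMax_four_le items20 checkDolls_items20 (by decide +kernel) (by decide +kernel)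
      (by decide +kernel)
  · exact smoothMax_four_le items24 checkDolls_items24 (by decide +kernel) (by decide +kernel)
      (by decide +kernel)
  · exact smoothMax_four_le items29 checkDolls_items29 (by decide +kernel) (by decide +kernel)
      (by decide +kernel)
  · exact smoothMax_four_le items34 checkDolls_items34 (by decide +kernel) (by decide +kernel)
      (by decide +kernel)
  · exact smoothMax_four_le items41 checkDolls_items41 (by decide +kernel) (by decide +kernel)
      (by decide +kernel)
  · exact smoothMax_four_le items59 checkDolls_items59 (by decide +kernel) (by decide +kernel)
      (by decide +kernel)
  · exact smoothMax_four_le items69 checkDolls_items69 (by decide +kernel) (by decide +kernel)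
      (by decide +kernel)
  · exact smoothMax_four_le items104 checkDolls_items104 (by decide +kernel) (by decide +kernel)
      (by decide +kernel)
  · exact smoothMax_four_le items174 checkDolls_items174 (by decide +kernel) (by decide +kernel)
      (by decide +kernel)
  · exact smoothMax_four_le items209 checkDolls_items209 (by decide +kernel) (by decide +kernel)
      (by decide +kernel)
  · exact smoothMax_four_le items293 checkDolls_items293 (by decide +kernel) (by decide +kernel)
      (by decide +kernel)

theorem primeSqProd_four : primeSqProd 4 = 44100 := by
  simp [primeSqProd, Finset.prod_range_succ]

theorem prod_one_sub_inv_four :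
    ∏ j ∈ Finset.range 4, (1 - 1 / (nthPrime j : ℝ)) = 8 / 35 := by
  simp [Finset.prod_range_succ]
  norm_num

theorem gammaBound_four_le : gammaBound 4 ≤ 0.6420 := by
  have h := gammaBound_le 4 upperJumpSet (by rw [primeSqProd_four]; decide +kernel)
    smoothMax_le_card_filter fun i => by
      rw [smoothMax_eq_capMax]
      obtain ⟨S, hS, -, hcard⟩ := exists_card_eq_capMax 4 i
      rw [← hcard]
      exact cap_card_le_twenty hS
  rw [prod_one_sub_inv_four] at h
  refine h.trans ?_
  simp [upperJumpSet]
  norm_num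

theorem le_gammaBound_four : 0.64192 ≤ gammaBound 4 := by
  have h := le_gammaBound 4 jumpSet (by rw [primeSqProd_four]; decide +kernel)
    card_filter_jumpSet_le
  rw [prod_one_sub_inv_four] at h
  refine le_trans ?_ h
  simp [jumpSet]
  norm_num

theorem le_primeTail_four : 0.96966 ≤ primeTail 4 := by
  have h := prod_mul_primeTail 4
  rw [primeTail_zero] at h
  simp only [Finset.prod_range_succ, Finset.prod_range_zero, nthPrime_zero, nthPrime_one,
    nthPrime_two, nthPrime_three] at h
  have hpi : Real.pi ^ 2 < 9.86966 := by
    have h1 := Real.pi_lt_d4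
    have h2 := Real.pi_pos
    nlinarith
  have h3 : (6 : ℝ) / 9.86966 ≤ 6 / Real.pi ^ 2 :=
    div_le_div_of_nonneg_left (by norm_num) (by have := Real.pi_pos; positivity) hpi.le
  rw [← h] at h3
  norm_num at h3 ⊢
  linarith

theorem le_betaBound_four : 0.6224 ≤ betaBound 4 := by
  rw [betaBound_eq]
  calc (0.6224 : ℝ) ≤ 0.64192 * 0.96966 := by norm_num
    _ ≤ gammaBound 4 * primeTail 4 := mul_le_mul le_gammaBound_four le_primeTail_four (by norm_num)
      (le_trans (by norm_num) le_gammaBound_four)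

theorem mainTheorem2 :
    (∀ r i : ℕ, smoothMax r i = capMax r i) ∧
    ∃ c : ℝ, 0.6224 ≤ c ∧ c ≤ 0.6420 ∧
      Tendsto (fun n : ℕ => (extremalF 3 3 n : ℝ) / (n : ℝ)) atTop (𝓝 c) ∧
      IsGLB (gammaBound '' Set.Ici 1) c ∧
      IsLUB (betaBound '' Set.Ici 1) c := by
  obtain ⟨c, hc, hglb, hlub⟩ := exists_limit
  exact ⟨smoothMax_eq_capMax, c, le_betaBound_four.trans (hlub.1 ⟨4, by simp, rfl⟩),
    (hglb.1 ⟨4, by simp, rfl⟩).trans gammaBound_four_le, hc, hglb, hlub⟩
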